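/- Let $E$ be a complex Hilbert space and let $\Omega$ be the set of positive definite (positive and invertible) bounded operators on $E$, with the Loewner order ($A\le B$ iff $B-A$ is positive semidefinite) and the operator norm topology (which is also the topology of the Thompson metric). A $k$-mean on $\Omega$ is a map $\mu:\Omega^k\to\Omega$ with $\mu(A,\ldots,A)=A$ for all $A$. For a continuous $k$-mean $\mu$ let $$\beta_\mu:\Omega^{k+1}\to\Omega^{k+1},\qquad \beta_\mu(x)_i=\mu(x_1,\ldots,x_{i-1},x_{i+1},\ldots,x_{k+1}).$$ A $(k+1)$-mean $\nu$ is the $\beta$-extension of $\mu$ if $\lim_{m}\beta_\mu^m(x)=(\nu(x),\ldots,\nu(x))$ for every $x\in\Omega^{k+1}$. Let $L$ be the operator logarithmic mean, $L(A,B)=A^{1/2}f(A^{-1/2}BA^{-1/2})A^{1/2}$ with $f(x)=\frac{x-1}{\log x}$, $f(1)=1$. Let $A\#B=A^{1/2}(A^{-1/2}BA^{-1/2})^{1/2}A^{1/2}$, and let $AGM(A,B)$ be the arithmetic-geometric mean, that is, the common limit of the sequences $$\lambda_1=A\#B,\quad \nu_1=\tfrac12(A+B),\quad \lambda_{n+1}=\lambda_n\#\nu_n,\quad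 \nu_{n+1}=\tfrac12(\lambda_n+\nu_n).$$ Then these two sequences converge to the same limit for all $A,B\in\Omega$, so that $AGM$ is a well-defined $2$-mean. Starting from $L_2=L$ and $AGM_2=AGM$ there are $n$-means $L_n$ and $AGM_n$ on $\Omega$ for all $n>2$, each of which is the $\beta$-extension of the preceding (continuous) one. For every $n>2$ and all $A_1,\ldots,A_n\in\Omega$, $$L_n(A_1,\ldots,A_n)\le AGM_n(A_1,\ldots,A_n).$$ -/

import Mathlib

open Filter Topology

/-! ### Means on a set, iterated composition, and extension by the barycentric operator -/

section Means

variable {X : Type*}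

/-- A `k`-ary operation is a `k`-mean if it is idempotent: `μ (x, …, x) = x`. -/
def IsMean {k : ℕ} (μ : (Fin k → X) → X) : Prop :=
  ∀ x : X, μ (fun _ => x) = x

/-- The barycentric operator of a `k`-ary operation `μ`: the `i`-th entry of `barycentric μ x` is
`μ` applied to the `k`-tuple obtained from the `(k+1)`-tuple `x` by deleting its `i`-th entry. -/
def barycentric {k : ℕ} (μ : (Fin k → X) → X) (x : Fin (k + 1) → X) : Fin (k + 1) → X :=
  fun i => μ (i.removeNth x)

/-- The pair `(λₙ(x, y), νₙ(x, y))` of the iteration of the two `2`-means `lam` and `nu`, indexed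
from `0`: it starts with `(λ(x, y), ν(x, y))`, and `(λₙ₊₁, νₙ₊₁) = (λ(λₙ, νₙ), ν(λₙ, νₙ))`. -/
def iterPair (lam nu : (Fin 2 → X) → X) (x : Fin 2 → X) : ℕ → Fin 2 → X
  | 0 => ![lam x, nu x]
  | n + 1 => ![lam (iterPair lam nu x n), nu (iterPair lam nu x n)]

variable [TopologicalSpace X]

/-- `ν` is a `β`-extension of the topological `k`-mean `μ`: `μ` is a continuous mean, `ν` is a mean,
and the powers of the barycentric operator of `μ` converge pointwise to the diagonal tuple with
entries `ν x`. -/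
structure IsBetaExtension {k : ℕ} (μ : (Fin k → X) → X) (ν : (Fin (k + 1) → X) → X) : Prop where
  isMean : IsMean μ
  continuous : Continuous μ
  isMean_ext : IsMean ν
  tendsto : ∀ x : Fin (k + 1) → X,
    Tendsto (fun n : ℕ => (barycentric μ)^[n] x) atTop (𝓝 (fun _ => ν x))

/-- The family `(μₙ)`, `n ≥ 2`, consists of the inductive `β`-extensions of the `2`-mean `μ`:
`μ₂ = μ`, and `μₙ₊₁` is a `β`-extension of `μₙ` for each `n ≥ 2` (the entries with `n < 2` play
no role). -/
structure IsBetaExtensionFamily (μ : (Fin 2 → X) → X) (μs : (n : ℕ) → (Fin n → X) → X) :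
    Prop where
  two : μs 2 = μ
  extends_succ : ∀ n, 2 ≤ n → IsBetaExtension (μs n) (μs (n + 1))

/-- `μ` is the iterated composition of the `2`-means `lam` and `nu`: it is a mean and the pointwise
limit of both sequences of the iteration. -/
structure IsIteratedComposition (lam nu μ : (Fin 2 → X) → X) : Prop where
  isMean : IsMean μ
  tendsto_left : ∀ x, Tendsto (fun n => iterPair lam nu x n 0) atTop (𝓝 (μ x))
  tendsto_right : ∀ x, Tendsto (fun n => iterPair lam nu x n 1) atTop (𝓝 (μ x))

/-- The pointwise limit of the first sequence of the iteration (a junk value where there is no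
limit). -/
noncomputable def iteratedLimit [Nonempty X] (lam nu : (Fin 2 → X) → X) : (Fin 2 → X) → X :=
  fun x => limUnder atTop (fun n => iterPair lam nu x n 0)

end Means

/-! ### The logarithmic mean of positive reals -/

/-- The logarithmic mean `(b - a) / (log b - log a)` of `a, b > 0`, equal to `a` for `a = b`. -/
noncomputable def realLogMean (a b : ℝ) : ℝ :=
  if a = b then a else (b - a) / (Real.log b - Real.log a)

theorem realLogMean_one_pos {x : ℝ} (hx : 0 < x) : 0 < realLogMean 1 x := by
  unfold realLogMean
  split_ifs with h
  · exact one_pos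
  · rw [Real.log_one, sub_zero]
    rcases lt_or_gt_of_ne h with h | h
    · exact div_pos (by linarith) (Real.log_pos h)
    · exact div_pos_of_neg_of_neg (by linarith) (Real.log_neg hx h)

theorem continuousOn_realLogMean_one : ContinuousOn (realLogMean 1) (Set.Ioi 0) := by
  have hf : realLogMean 1 = fun x => (dslope Real.log 1 x)⁻¹ := by
    funext x
    unfold realLogMean
    split_ifs with h
    · subst h
      simp [dslope_same]
    · rw [dslope_of_ne _ (Ne.symm h), slope_def_field, inv_div]
  have hd : ∀ x ∈ Set.Ioi (0 : ℝ), ContinuousAt (dslope Real.log 1) x := by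
    intro x hx
    by_cases h : x = 1
    · subst h
      exact continuousAt_dslope_same.2 (Real.differentiableAt_log one_ne_zero)
    · exact (continuousAt_dslope_of_ne h).2 (Real.continuousAt_log (ne_of_gt hx))
  intro x hx
  have hpos : 0 < (dslope Real.log 1 x)⁻¹ := by
    have := realLogMean_one_pos hx
    rwa [hf] at this
  rw [hf]
  exact ((hd x hx).inv₀ (inv_pos.1 hpos).ne').continuousWithinAt

/-! ### Means of positive definite operators -/

section Operators

/-- The set `Ω` of positive definite (positive and invertible) bounded operators on the complex
Hilbert space `E`, with the Loewner order and the operator norm topology (which is also the topology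
of the Thompson metric). -/
abbrev PosDefOp (E : Type*) [NormedAddCommGroup E] [InnerProductSpace ℂ E] [CompleteSpace E] :=
  {A : E →L[ℂ] E // IsStrictlyPositive A}

variable {E : Type*} [NormedAddCommGroup E] [InnerProductSpace ℂ E] [CompleteSpace E]

instance PosDefOp.instNonempty : Nonempty (PosDefOp E) := ⟨⟨1, isStrictlyPositive_one⟩⟩

/-- `A^{1/2} f(A^{-1/2} B A^{-1/2}) A^{1/2}`, with `f` applied by the functional calculus. -/
noncomputable def meanOfFun (f : ℝ → ℝ) (A B : E →L[ℂ] E) : E →L[ℂ] E :=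
  A ^ (1 / 2 : ℝ) * cfc f (A ^ (-(1 / 2) : ℝ) * B * A ^ (-(1 / 2) : ℝ)) * A ^ (1 / 2 : ℝ)

theorem isStrictlyPositive_meanOfFun {f : ℝ → ℝ} (hc : ContinuousOn f (Set.Ioi 0))
    (hpos : ∀ x, 0 < x → 0 < f x) {A B : E →L[ℂ] E} (hA : IsStrictlyPositive A)
    (hB : IsStrictlyPositive B) : IsStrictlyPositive (meanOfFun f A B) := by
  have h1 : IsStrictlyPositive (A ^ (1 / 2 : ℝ)) := hA.rpow A _
  have h2 : IsStrictlyPositive (A ^ (-(1 / 2) : ℝ)) := hA.rpow A _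
  have h3 : IsStrictlyPositive (A ^ (-(1 / 2) : ℝ) * B * A ^ (-(1 / 2) : ℝ)) :=
    IsStrictlyPositive.conjugate_of_isUnit_of_isSelfAdjoint _ _ h2.isUnit h2.isSelfAdjoint hB
  refine IsStrictlyPositive.conjugate_of_isUnit_of_isSelfAdjoint _ _ h1.isUnit h1.isSelfAdjoint ?_
  rw [cfc_isStrictlyPositive_iff f _ (hc.mono fun x hx => h3.spectrum_pos hx) h3.isSelfAdjoint]
  exact fun x hx => hpos x (h3.spectrum_pos hx)

/-- The operator mean on `Ω` with representing function `f` (the values of `f` outside of `(0, ∞)`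
play no role). -/
noncomputable def operatorMean (f : ℝ → ℝ) (hc : ContinuousOn f (Set.Ioi 0))
    (hpos : ∀ x, 0 < x → 0 < f x) : (Fin 2 → PosDefOp E) → PosDefOp E :=
  fun A => ⟨meanOfFun f (A 0).1 (A 1).1, isStrictlyPositive_meanOfFun hc hpos (A 0).2 (A 1).2⟩

/-- The geometric mean `A # B = A^{1/2} (A^{-1/2} B A^{-1/2})^{1/2} A^{1/2}`. -/
noncomputable def geomMean : (Fin 2 → PosDefOp E) → PosDefOp E :=
  operatorMean Real.sqrt Real.continuous_sqrt.continuousOn fun _ => Real.sqrt_pos.2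

/-- The arithmetic mean `(A + B) / 2`. -/
noncomputable def arithMean : (Fin 2 → PosDefOp E) → PosDefOp E :=
  fun A => ⟨(1 / 2 : ℝ) • ((A 0).1 + (A 1).1),
    IsStrictlyPositive.smul (by norm_num) (isStrictlyPositive_add (Or.inl ⟨(A 0).2, (A 1).2.nonneg⟩))⟩

/-- The operator logarithmic mean: the operator mean whose representing function is
`x ↦ L(1, x) = (x - 1) / log x`. -/
noncomputable def logMean : (Fin 2 → PosDefOp E) → PosDefOp E :=
  operatorMean (realLogMean 1) continuousOn_realLogMean_one fun _ => realLogMean_one_pos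

/-- The arithmetic-geometric mean: the limit of the iteration of the geometric and the arithmetic
mean. -/
noncomputable def agMean : (Fin 2 → PosDefOp E) → PosDefOp E :=
  iteratedLimit geomMean arithMean

end Operators

/-!
The proof works with the class `IsContractiveMean` of means of positive definite operators that are
symmetric, monotone, positively homogeneous, and contractive in each variable separately for the
Thompson metric, with a rate `ρ < 1` that depends only on a bound for the mutual ratios of the
entries.

For such a mean `μ` the tuples with the `i`-th and with the `j`-th entry deleted agree, up to order,
except for one entry, so the barycentric operator contracts the Thompson diameter of a tuple by the
factor `ρ`, and it does not increase the ratios of the entries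
(`IsContractiveMean.barycentric_contract`). Hence its powers converge to the diagonal
(`IsContractiveMean.exists_tendsto_iterate`). The limit `ν` satisfies `ν (β x) = ν x`, from which it
inherits all of the properties, with the same rate (`IsContractiveMean.of_isBetaExtension`).
Continuity is automatic, because monotone and homogeneous operations are nonexpansive for the
Thompson metric, which induces the norm topology. So every contractive mean of two variables has
`β`-extensions of all orders.

The geometric mean `A # B` is symmetric and is computed on commuting operators by the Riccati
equation `G A⁻¹ G = B` that characterizes it. It is monotone because the square root is operator
monotone. The two means of the theorem are built from it and the arithmetic mean.
* The arithmetic-geometric iteration converges because `λₙ` increases and `νₙ₊₁ - λₙ₊₁` is at most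
  `(νₙ - λₙ) / 2`. Its limit is contractive because the first step contracts.
* The logarithmic mean satisfies `L(A, B) = (L(A, A # B) + L(A # B, B)) / 2`, and iterating this from
  the arithmetic mean gives approximations, with an error `O(2⁻ⁿ)`, that involve geometric and
  arithmetic means only (`tendsto_trapezoid`). So it is symmetric and monotone, and the splitting
  shows that it is contractive.

For positive reals, `L(a, b) ≤ L(√(a b), (a + b) / 2)`
(`realLogMean_le_realLogMean_sqrt_half`), hence the sequence `νₙ` stays above `L(a, b)`. By
functional calculus the same holds for operators, so that `L ≤ AGM` (`logMean_le_agMean`), and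
monotonicity carries the inequality through the `β`-extensions.
-/

/-! ### The logarithmic mean of positive reals -/

theorem realLogMean_comm (a b : ℝ) : realLogMean a b = realLogMean b a := by
  unfold realLogMean
  by_cases h : a = b
  · simp [h]
  · rw [if_neg h, if_neg (Ne.symm h), ← neg_sub b a, ← neg_sub (Real.log b), neg_div_neg_eq]

theorem realLogMean_self (a : ℝ) : realLogMean a a = a := if_pos rfl

theorem realLogMean_mul_left {a b t : ℝ} (ha : 0 < a) (hb : 0 < b) (ht : 0 < t) :
    realLogMean (t * a) (t * b) = t * realLogMean a b := by
  unfold realLogMean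
  by_cases h : a = b
  · simp [h]
  · rw [if_neg h, if_neg (fun h' => h (mul_left_cancel₀ ht.ne' h')),
      Real.log_mul ht.ne' hb.ne', Real.log_mul ht.ne' ha.ne', add_sub_add_left_eq_sub, ← mul_sub,
      mul_div_assoc]

/-- With `x = v ^ 2`, this is `2 (x - 1) / (x + 1) ≤ log x`, the inequality between the logarithmic
and the arithmetic mean. -/
theorem sq_sub_one_le_log_mul {v : ℝ} (hv : 1 ≤ v) : v ^ 2 - 1 ≤ Real.log v * (v ^ 2 + 1) := by
  have h := Real.le_log_one_add_of_nonneg (x := v ^ 2 - 1) (by nlinarith)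
  rw [div_le_iff₀ (by nlinarith), add_sub_cancel, Real.log_pow] at h
  push_cast at h
  linarith

/-- With `x = v ^ 2`, this is `log x ≤ (x - 1) / √x`, the inequality between the geometric and the
logarithmic mean. -/
theorem two_mul_log_mul_le {v : ℝ} (hv : 1 ≤ v) : 2 * Real.log v * v ≤ v ^ 2 - 1 := by
  have hv0 : 0 < v := by linarith
  have h := Real.self_le_sinh_iff.2 (Real.log_nonneg hv)
  rw [Real.sinh_log hv0] at h
  have := mul_le_mul_of_nonneg_right h hv0.le
  field_simp at this
  linarith

/-- Reduction of a homogeneous symmetric inequality to the pairs `(1, v ^ 2)` with `v > 1`, for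
positive arguments. -/
theorem homogeneous_le_of_one_sq {f g : ℝ → ℝ → ℝ} (hf : ∀ a b, f a b = f b a)
    (hg : ∀ a b, g a b = g b a)
    (hf' : ∀ a b t, 0 < a → 0 < b → 0 < t → f (t * a) (t * b) = t * f a b)
    (hg' : ∀ a b t, 0 < a → 0 < b → 0 < t → g (t * a) (t * b) = t * g a b)
    (hdiag : f 1 1 ≤ g 1 1) (h : ∀ v, 1 < v → f 1 (v ^ 2) ≤ g 1 (v ^ 2))
    {a b : ℝ} (ha : 0 < a) (hb : 0 < b) : f a b ≤ g a b := by
  wlog hab : a ≤ b generalizing a b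
  · rw [hf a b, hg a b]
    exact this hb ha (le_of_not_ge hab)
  have hb' : b = a * √(b / a) ^ 2 := by
    rw [Real.sq_sqrt (by positivity)]
    field_simp
  have key : f 1 (√(b / a) ^ 2) ≤ g 1 (√(b / a) ^ 2) := by
    rcases ((one_le_div ha).2 hab).eq_or_lt with h1 | h1
    · simpa [← h1] using hdiag
    · exact h _ (Real.lt_sqrt_of_sq_lt (by simpa using h1))
  have hpos : 0 < √(b / a) ^ 2 := by positivity
  have e1 := hf' 1 (√(b / a) ^ 2) a one_pos hpos ha
  have e2 := hg' 1 (√(b / a) ^ 2) a one_pos hpos ha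
  rw [mul_one, ← hb'] at e1 e2
  rw [e1, e2]
  exact mul_le_mul_of_nonneg_left key ha.le

theorem realLogMean_one_sq {v : ℝ} (hv : 1 < v) :
    realLogMean 1 (v ^ 2) = (v ^ 2 - 1) / (2 * Real.log v) := by
  unfold realLogMean
  rw [if_neg (by nlinarith), Real.log_one, sub_zero, Real.log_pow]
  norm_num

theorem sqrt_mul_mul_left {a b t : ℝ} (ht : 0 < t) : √(t * a * (t * b)) = t * √(a * b) := by
  rw [show t * a * (t * b) = t ^ 2 * (a * b) by ring, Real.sqrt_mul (by positivity),
    Real.sqrt_sq ht.le]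

theorem sqrt_mul_le_realLogMean {a b : ℝ} (ha : 0 < a) (hb : 0 < b) :
    √(a * b) ≤ realLogMean a b := by
  refine homogeneous_le_of_one_sq (f := fun a b => √(a * b)) (fun a b => by rw [mul_comm])
    realLogMean_comm (fun a b t _ _ ht => sqrt_mul_mul_left ht)
    (fun a b t ha hb ht => realLogMean_mul_left ha hb ht) ?_ ?_ ha hb
  · simp [realLogMean_self]
  · intro v hv
    have hl := Real.log_pos hv
    rw [realLogMean_one_sq hv, one_mul, Real.sqrt_sq (by linarith), le_div_iff₀ (by positivity)]
    linarith [two_mul_log_mul_le hv.le]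

theorem realLogMean_le_half_add {a b : ℝ} (ha : 0 < a) (hb : 0 < b) :
    realLogMean a b ≤ (a + b) / 2 := by
  refine homogeneous_le_of_one_sq (g := fun a b => (a + b) / 2) realLogMean_comm
    (fun a b => by rw [add_comm])
    (fun a b t ha hb ht => realLogMean_mul_left ha hb ht) (fun a b t _ _ _ => by ring) ?_ ?_ ha hb
  · simp [realLogMean_self]
  · intro v hv
    have hl := Real.log_pos hv
    rw [realLogMean_one_sq hv, div_le_iff₀ (by positivity)]
    linarith [sq_sub_one_le_log_mul hv.le]

/-- The logarithmic mean splits at the geometric mean, because `log √(a b)` is the midpoint of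
`log a` and `log b`. -/
theorem realLogMean_split {a b : ℝ} (ha : 0 < a) (hb : 0 < b) :
    realLogMean a b = (realLogMean a √(a * b) + realLogMean √(a * b) b) / 2 := by
  by_cases h : a = b
  · simp [h, Real.sqrt_mul_self hb.le, realLogMean_self]
  have hab : 0 < a * b := mul_pos ha hb
  have hs : 0 < √(a * b) := Real.sqrt_pos.2 hab
  have h1 : a ≠ √(a * b) := fun h' => h (by
    have := Real.sq_sqrt hab.le
    rw [← h', sq] at this
    exact mul_left_cancel₀ ha.ne' this)
  have h2 : √(a * b) ≠ b := fun h' => h (by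
    have := Real.sq_sqrt hab.le
    rw [h', sq] at this
    exact (mul_right_cancel₀ hb.ne' this).symm)
  have hl : Real.log b - Real.log a ≠ 0 := fun h' =>
    h (Real.log_injOn_pos ha hb (sub_eq_zero.1 h').symm)
  unfold realLogMean
  rw [if_neg h, if_neg h1, if_neg h2, Real.log_sqrt hab.le, Real.log_mul ha.ne' hb.ne']
  rw [show (Real.log a + Real.log b) / 2 - Real.log a = (Real.log b - Real.log a) / 2 by ring,
    show Real.log b - (Real.log a + Real.log b) / 2 = (Real.log b - Real.log a) / 2 by ring]
  field_simp
  ring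

/-- The inequality `L(1, v²) ≤ L(v, (1 + v²) / 2)` with the denominators cleared. The difference of the
two sides, divided by `v + 1`, vanishes at `v = 1`, and its derivative is nonnegative by the
inequality between the logarithmic and the arithmetic mean. -/
theorem log_half_sq_add_one_mul_le {v : ℝ} (hv : 1 ≤ v) :
    (v + 1) * Real.log ((v ^ 2 + 1) / 2) ≤ 2 * v * Real.log v := by
  let h : ℝ → ℝ := fun v => 2 * v * Real.log v / (v + 1) - Real.log ((v ^ 2 + 1) / 2)
  have hd : ∀ x : ℝ, 1 ≤ x → HasDerivAt h
      (((2 * Real.log x + 2) * (x + 1) - 2 * x * Real.log x) / (x + 1) ^ 2 -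
        2 * x / (x ^ 2 + 1)) x := by
    intro x hx
    have hx0 : x ≠ 0 := by positivity
    have h1 : HasDerivAt (fun v : ℝ => 2 * v * Real.log v) (2 * Real.log x + 2) x :=
      (((hasDerivAt_id' x).const_mul 2).mul (Real.hasDerivAt_log hx0)).congr_deriv (by field_simp)
    have h2 : HasDerivAt (fun v : ℝ => v + 1) 1 x := (hasDerivAt_id' x).add_const 1
    have h3 : HasDerivAt (fun v : ℝ => (v ^ 2 + 1) / 2) x x :=
      (((hasDerivAt_id' x).pow 2 |>.add_const 1).div_const 2).congr_deriv (by simp)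
    refine ((h1.div h2 (by positivity)).sub (h3.log (by positivity))).congr_deriv ?_
    rw [mul_one]
    congr 1
    field_simp
  have hmono : MonotoneOn h (Set.Ici 1) := by
    refine monotoneOn_of_deriv_nonneg (convex_Ici 1)
      (fun x hx => (hd x hx).continuousAt.continuousWithinAt)
      (fun x hx => (hd x (interior_subset hx)).differentiableAt.differentiableWithinAt) ?_
    intro x hx
    have hx1 : 1 ≤ x := interior_subset hx
    rw [(hd x hx1).deriv, sub_nonneg, div_le_div_iff₀ (by positivity) (by positivity)]
    nlinarith [sq_sub_one_le_log_mul hx1]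
  have := hmono (Set.mem_Ici.2 le_rfl) (Set.mem_Ici.2 hv) hv
  simp only [h] at this
  norm_num at this
  rw [le_div_iff₀ (by positivity)] at this
  linarith

/-- The logarithmic mean increases along the arithmetic-geometric iteration. -/
theorem realLogMean_le_realLogMean_sqrt_half {a b : ℝ} (ha : 0 < a) (hb : 0 < b) :
    realLogMean a b ≤ realLogMean √(a * b) ((a + b) / 2) := by
  refine homogeneous_le_of_one_sq (g := fun a b => realLogMean √(a * b) ((a + b) / 2))
    realLogMean_comm (fun a b => by rw [add_comm, mul_comm])
    (fun a b t ha hb ht => realLogMean_mul_left ha hb ht) (fun a b t ha hb ht => ?_) ?_ ?_ ha hb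
  · rw [sqrt_mul_mul_left ht, ← mul_add, mul_div_assoc,
      realLogMean_mul_left (by positivity) (by positivity) ht]
  · simp [realLogMean_self]
  · intro v hv
    have hv0 : 0 < v := by linarith
    have hlt : v < (1 + v ^ 2) / 2 := by nlinarith [sq_nonneg (v - 1), mul_pos hv0 hv0]
    have hl := Real.log_pos hv
    have hl' : 0 < Real.log ((1 + v ^ 2) / 2) - Real.log v :=
      sub_pos.2 (Real.log_lt_log hv0 hlt)
    have key := log_half_sq_add_one_mul_le hv.le
    rw [add_comm (v ^ 2) 1] at key
    rw [realLogMean_one_sq hv, one_mul, Real.sqrt_sq hv0.le]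
    unfold realLogMean
    rw [if_neg hlt.ne, div_le_div_iff₀ (by positivity) hl']
    nlinarith [mul_nonneg (sub_nonneg.2 hv.le) (sub_nonneg.2 key)]

/-- The trapezoidal approximations of the logarithmic mean: halving an interval at its geometric
mean, `n` times, starting from the arithmetic mean. -/
noncomputable def realTrapezoid : ℕ → ℝ → ℝ → ℝ
  | 0, a, b => (a + b) / 2
  | n + 1, a, b => (realTrapezoid n a √(a * b) + realTrapezoid n √(a * b) b) / 2

theorem realLogMean_le_realTrapezoid (n : ℕ) {a b : ℝ} (ha : 0 < a) (hb : 0 < b) :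
    realLogMean a b ≤ realTrapezoid n a b := by
  induction n generalizing a b with
  | zero => exact realLogMean_le_half_add ha hb
  | succ n ih =>
    have hs : 0 < √(a * b) := Real.sqrt_pos.2 (mul_pos ha hb)
    rw [realLogMean_split ha hb, realTrapezoid]
    linarith [ih ha hs, ih hs hb]

/-- The error of the trapezoidal approximation is at most halved in each step, because
`(√g - √a) ^ 2 + (√b - √g) ^ 2 ≤ (√b - √a) ^ 2` for `g` between `a` and `b`. -/
theorem realTrapezoid_sub_le (n : ℕ) {a b : ℝ} (ha : 0 < a) (hb : 0 < b) :
    realTrapezoid n a b - realLogMean a b ≤ (1 / 2) ^ n * ((√b - √a) ^ 2 / 2) := by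
  induction n generalizing a b with
  | zero =>
    have := sqrt_mul_le_realLogMean ha hb
    rw [Real.sqrt_mul ha.le] at this
    rw [realTrapezoid, sub_sq, Real.sq_sqrt ha.le, Real.sq_sqrt hb.le]
    linarith
  | succ n ih =>
    have hs : 0 < √(a * b) := Real.sqrt_pos.2 (mul_pos ha hb)
    have h1 := ih ha hs
    have h2 := ih hs hb
    have h3 : (√√(a * b) - √a) ^ 2 + (√b - √√(a * b)) ^ 2 ≤ (√b - √a) ^ 2 := by
      have : 0 ≤ (√√(a * b) - √a) * (√b - √√(a * b)) := by
        rcases le_total a b with h | h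
        · have e1 : √a ≤ √√(a * b) := Real.sqrt_le_sqrt (Real.le_sqrt_of_sq_le (by nlinarith))
          have e2 : √√(a * b) ≤ √b := Real.sqrt_le_sqrt (Real.sqrt_le_iff.2 ⟨hb.le, by nlinarith⟩)
          exact mul_nonneg (sub_nonneg.2 e1) (sub_nonneg.2 e2)
        · have e1 : √b ≤ √√(a * b) := Real.sqrt_le_sqrt (Real.le_sqrt_of_sq_le (by nlinarith))
          have e2 : √√(a * b) ≤ √a := Real.sqrt_le_sqrt (Real.sqrt_le_iff.2 ⟨ha.le, by nlinarith⟩)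
          exact mul_nonneg_of_nonpos_of_nonpos (sub_nonpos.2 e2) (sub_nonpos.2 e1)
      linarith
    have h4 := mul_le_mul_of_nonneg_left h3 (by positivity : (0 : ℝ) ≤ (1 / 2) ^ n)
    rw [realLogMean_split ha hb, realTrapezoid, pow_succ]
    linarith

theorem realTrapezoid_le (n : ℕ) {a b : ℝ} (ha : 0 < a) (hb : 0 < b) :
    realTrapezoid n a b ≤ realLogMean a b + (1 / 2) ^ n * ((a + b) / 2) := by
  have h : (√b - √a) ^ 2 / 2 ≤ (a + b) / 2 := by
    rw [sub_sq, Real.sq_sqrt ha.le, Real.sq_sqrt hb.le]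
    linarith [mul_nonneg (Real.sqrt_nonneg b) (Real.sqrt_nonneg a)]
  have := mul_le_mul_of_nonneg_left h (by positivity : (0 : ℝ) ≤ (1 / 2) ^ n)
  linarith [realTrapezoid_sub_le n ha hb]

/-- The second sequence of the arithmetic-geometric iteration stays above the logarithmic mean. -/
theorem realLogMean_le_iterPair (y : Fin 2 → ℝ) (h0 : 0 < y 0) (h1 : 0 < y 1) (n : ℕ) :
    let z := iterPair (fun y : Fin 2 → ℝ => √(y 0 * y 1)) (fun y => (y 0 + y 1) / 2) y n
    0 < z 0 ∧ 0 < z 1 ∧ realLogMean (y 0) (y 1) ≤ realLogMean (z 0) (z 1) := by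
  induction n with
  | zero =>
    exact ⟨Real.sqrt_pos.2 (mul_pos h0 h1), half_pos (add_pos h0 h1),
      realLogMean_le_realLogMean_sqrt_half h0 h1⟩
  | succ n ih =>
    obtain ⟨i0, i1, i2⟩ := ih
    exact ⟨Real.sqrt_pos.2 (mul_pos i0 i1), half_pos (add_pos i0 i1),
      i2.trans (realLogMean_le_realLogMean_sqrt_half i0 i1)⟩

/-! ### Order comparison and norm estimates for positive definite operators -/

section Comparison

variable {E : Type*} [NormedAddCommGroup E] [InnerProductSpace ℂ E] [CompleteSpace E]

theorem PosDefOp.le_smul_of_le {A B : PosDefOp E} {s t : ℝ} (h : A.1 ≤ s • B.1) (hst : s ≤ t) :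
    A.1 ≤ t • B.1 :=
  h.trans (smul_le_smul_of_nonneg_right hst B.2.nonneg)

theorem PosDefOp.exists_pos_smul_one_le (A : PosDefOp E) :
    ∃ r : ℝ, 0 < r ∧ r • (1 : E →L[ℂ] E) ≤ A.1 := by
  rcases subsingleton_or_nontrivial (E →L[ℂ] E) with h | h
  · exact ⟨1, one_pos, (Subsingleton.elim _ _).le⟩
  · obtain ⟨r, hr, h⟩ := (CFC.exists_pos_algebraMap_le_iff (a := A.1) A.2.isSelfAdjoint).2
      fun x hx => A.2.spectrum_pos hx
    exact ⟨r, hr, by rwa [Algebra.algebraMap_eq_smul_one] at h⟩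

theorem le_norm_smul_one {a : E →L[ℂ] E} (ha : IsSelfAdjoint a) : a ≤ ‖a‖ • 1 := by
  rw [← Algebra.algebraMap_eq_smul_one]
  exact ha.le_algebraMap_norm_self

theorem PosDefOp.exists_le_smul (A B : PosDefOp E) : ∃ t : ℝ, 1 ≤ t ∧ A.1 ≤ t • B.1 := by
  obtain ⟨r, hr, h⟩ := B.exists_pos_smul_one_le
  have h1 : A.1 ≤ (‖A.1‖ / r) • B.1 := by
    refine (le_norm_smul_one A.2.isSelfAdjoint).trans ?_
    have := smul_le_smul_of_nonneg_left h (show 0 ≤ ‖A.1‖ / r by positivity)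
    rwa [smul_smul, div_mul_cancel₀ _ hr.ne'] at this
  exact ⟨max 1 (‖A.1‖ / r), le_max_left _ _, PosDefOp.le_smul_of_le h1 (le_max_right _ _)⟩

/-- The entries of a tuple are at finite Thompson distance from each other. -/
theorem PosDefOp.exists_forall_le_smul {ι : Type*} [Fintype ι] (x : ι → PosDefOp E) :
    ∃ κ : ℝ, 1 ≤ κ ∧ ∀ i j, (x i).1 ≤ κ • (x j).1 := by
  choose t ht h using fun p : ι × ι => PosDefOp.exists_le_smul (x p.1) (x p.2)
  refine ⟨1 + ∑ p, t p, ?_, fun i j => PosDefOp.le_smul_of_le (h (i, j)) ?_⟩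
  · linarith [Finset.sum_nonneg fun p (_ : p ∈ Finset.univ) => zero_le_one.trans (ht p)]
  · linarith [Finset.single_le_sum (f := t) (fun p _ => zero_le_one.trans (ht p))
      (Finset.mem_univ (i, j))]

/-- Operators that are close in the Thompson metric are close in norm. -/
theorem norm_sub_le_of_le_smul {a b : E →L[ℂ] E} (ha : 0 ≤ a) {R : ℝ} (hR : 1 ≤ R)
    (h1 : b ≤ R • a) (h2 : a ≤ R • b) : ‖b - a‖ ≤ 3 * (R - 1) * ‖a‖ := by
  have hR0 : 0 < R := by linarith
  have h3 : R⁻¹ • a ≤ b := by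
    have := smul_le_smul_of_nonneg_left h2 (inv_nonneg.2 hR0.le)
    rwa [smul_smul, inv_mul_cancel₀ hR0.ne', one_smul] at this
  have hRi : 1 - R⁻¹ ≤ R - 1 := by
    have := mul_inv_cancel₀ hR0.ne'
    have h0 : 0 ≤ R⁻¹ := by positivity
    nlinarith [sq_nonneg (R - 1)]
  have h4 : R • a - b ≤ (2 * (R - 1)) • a := by
    refine (sub_le_sub_left h3 _).trans ?_
    rw [← sub_smul]
    exact smul_le_smul_of_nonneg_right (by linarith) ha
  have h5 := CStarAlgebra.norm_le_norm_of_nonneg_of_le (sub_nonneg.2 h1) h4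
  rw [norm_smul, Real.norm_of_nonneg (by linarith)] at h5
  calc ‖b - a‖ = ‖(R - 1) • a - (R • a - b)‖ := by
        congr 1
        rw [sub_smul, one_smul]
        abel
    _ ≤ ‖(R - 1) • a‖ + ‖R • a - b‖ := norm_sub_le _ _
    _ ≤ (R - 1) * ‖a‖ + 2 * (R - 1) * ‖a‖ := by
        rw [norm_smul, Real.norm_of_nonneg (by linarith : 0 ≤ R - 1)]
        linarith
    _ = 3 * (R - 1) * ‖a‖ := by ring

/-- Operators that are close in norm to a positive definite one are close to it in the Thompson
metric. -/
theorem PosDefOp.eventually_le_smul (A : PosDefOp E) {R : ℝ} (hR : 1 < R) :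
    ∀ᶠ B in 𝓝 A, B.1 ≤ R • A.1 ∧ A.1 ≤ R • B.1 := by
  obtain ⟨r, hr, h⟩ := A.exists_pos_smul_one_le
  have hR0 : 0 < R := by linarith
  have hε : 0 < (R - 1) / R * r := by
    have : 0 < R - 1 := by linarith
    positivity
  have hcont : ContinuousAt (fun B : PosDefOp E => ‖B.1 - A.1‖) A := by fun_prop
  have hnear : ∀ᶠ B in 𝓝 A, ‖B.1 - A.1‖ < (R - 1) / R * r :=
    hcont.eventually_lt continuousAt_const (by simpa using hε)
  filter_upwards [hnear] with B hB
  have key : ∀ c : E →L[ℂ] E, IsSelfAdjoint c → ‖c‖ < (R - 1) / R * r →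
      c ≤ ((R - 1) / R) • A.1 := by
    intro c hc hcn
    refine (le_norm_smul_one hc).trans ?_
    refine (smul_le_smul_of_nonneg_right hcn.le zero_le_one).trans ?_
    rw [mul_smul]
    exact smul_le_smul_of_nonneg_left h (div_nonneg (by linarith) hR0.le)
  have k1 := key (B.1 - A.1) (B.2.isSelfAdjoint.sub A.2.isSelfAdjoint) hB
  have k2 := key (A.1 - B.1) (A.2.isSelfAdjoint.sub B.2.isSelfAdjoint) (by rwa [norm_sub_rev])
  constructor
  · have h1 : (R - 1) / R ≤ R - 1 := by
      rw [div_le_iff₀ hR0]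
      nlinarith
    have := k1.trans (smul_le_smul_of_nonneg_right h1 A.2.nonneg)
    rwa [sub_le_iff_le_add, sub_smul, one_smul, sub_add_cancel] at this
  · have h1 : R⁻¹ • A.1 ≤ B.1 := by
      rw [show R⁻¹ = 1 - (R - 1) / R by field_simp; ring, sub_smul, one_smul]
      exact sub_le_comm.1 k2
    have := smul_le_smul_of_nonneg_left h1 hR0.le
    rwa [smul_smul, mul_inv_cancel₀ hR0.ne', one_smul] at this

end Comparison

/-! ### Symmetric contractive means and their extensions -/

section Extension

variable {X : Type*}

theorem barycentric_const {k : ℕ} {μ : (Fin k → X) → X} (hμ : IsMean μ) (a : X) :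
    barycentric μ (fun _ => a) = fun _ => a :=
  funext fun _ => hμ a

/-- The barycentric operator of a symmetric operation commutes with permutations. -/
theorem barycentric_comp_perm {k : ℕ} {μ : (Fin k → X) → X}
    (hμ : ∀ (σ : Equiv.Perm (Fin k)) x, μ (x ∘ σ) = μ x) (σ : Equiv.Perm (Fin (k + 1)))
    (x : Fin (k + 1) → X) : barycentric μ (x ∘ σ) = barycentric μ x ∘ σ := by
  funext i
  let τ : Equiv.Perm (Fin k) := (finSuccAboveEquiv i).trans
    ((σ.subtypeEquiv fun a => (σ.injective.ne_iff (x := a) (y := i)).symm).trans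
      (finSuccAboveEquiv (σ i)).symm)
  have hτ : ∀ l, (σ i).succAbove (τ l) = σ (i.succAbove l) := by
    intro l
    have h : finSuccAboveEquiv (σ i) (τ l) =
        (σ.subtypeEquiv fun a => (σ.injective.ne_iff (x := a) (y := i)).symm)
          (finSuccAboveEquiv i l) := by
      simp [τ]
    exact congrArg Subtype.val h
  change μ (i.removeNth (x ∘ σ)) = μ ((σ i).removeNth x)
  rw [← hμ τ ((σ i).removeNth x)]
  congr 1
  funext l
  exact (congrArg x (hτ l)).symm

theorem iterate_barycentric_comp_perm {k : ℕ} {μ : (Fin k → X) → X}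
    (hμ : ∀ (σ : Equiv.Perm (Fin k)) x, μ (x ∘ σ) = μ x) (σ : Equiv.Perm (Fin (k + 1)))
    (x : Fin (k + 1) → X) (n : ℕ) :
    (barycentric μ)^[n] (x ∘ σ) = (barycentric μ)^[n] x ∘ σ := by
  induction n generalizing x with
  | zero => rfl
  | succ n ih => rw [Function.iterate_succ_apply, barycentric_comp_perm hμ, ih,
      Function.iterate_succ_apply]

theorem IsBetaExtension.apply_barycentric [TopologicalSpace X] [T2Space X] {k : ℕ}
    {μ : (Fin k → X) → X} {ν : (Fin (k + 1) → X) → X} (h : IsBetaExtension μ ν)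
    (x : Fin (k + 1) → X) : ν (barycentric μ x) = ν x := by
  have h1 := (tendsto_add_atTop_iff_nat 1).2 (h.tendsto x)
  simp only [Function.iterate_succ_apply] at h1
  exact congrFun (tendsto_nhds_unique (h.tendsto (barycentric μ x)) h1) 0

theorem IsBetaExtension.of_tendsto [TopologicalSpace X] [T2Space X] {k : ℕ}
    {μ : (Fin k → X) → X} {ν : (Fin (k + 1) → X) → X} (hμ : IsMean μ) (hc : Continuous μ)
    (h : ∀ x, Tendsto (fun n : ℕ => (barycentric μ)^[n] x) atTop (𝓝 (fun _ => ν x))) :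
    IsBetaExtension μ ν where
  isMean := hμ
  continuous := hc
  isMean_ext a := by
    have h1 := h fun _ => a
    simp only [Function.iterate_fixed (barycentric_const hμ a)] at h1
    exact congrFun (tendsto_nhds_unique h1 tendsto_const_nhds) 0
  tendsto := h

theorem barycentric_mono [Preorder X] {k : ℕ} {μ μ' : (Fin k → X) → X} (hle : μ ≤ μ')
    (hμ' : Monotone μ') {x y : Fin (k + 1) → X} (h : x ≤ y) :
    barycentric μ x ≤ barycentric μ' y :=
  fun i => (hle _).trans (hμ' fun j => h (i.succAbove j))

theorem iterate_barycentric_mono [Preorder X] {k : ℕ} {μ μ' : (Fin k → X) → X} (hle : μ ≤ μ')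
    (hμ' : Monotone μ') (n : ℕ) {x y : Fin (k + 1) → X} (h : x ≤ y) :
    (barycentric μ)^[n] x ≤ (barycentric μ')^[n] y := by
  induction n generalizing x y with
  | zero => exact h
  | succ n ih => exact ih (barycentric_mono hle hμ' h)

/-- `β`-extensions preserve an inequality between means one of which, the larger, is monotone. -/
theorem IsBetaExtension.le_of_le [TopologicalSpace X] [Preorder X] [OrderClosedTopology X] {k : ℕ}
    {μ μ' : (Fin k → X) → X} {ν ν' : (Fin (k + 1) → X) → X} (h : IsBetaExtension μ ν)
    (h' : IsBetaExtension μ' ν') (hle : μ ≤ μ') (hμ' : Monotone μ') {x y : Fin (k + 1) → X}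
    (hxy : x ≤ y) : ν x ≤ ν' y :=
  le_of_tendsto_of_tendsto' ((tendsto_pi_nhds.1 (h.tendsto x)) 0)
    ((tendsto_pi_nhds.1 (h'.tendsto y)) 0) fun n => iterate_barycentric_mono hle hμ' n hxy 0

variable {E : Type*} [NormedAddCommGroup E] [InnerProductSpace ℂ E] [CompleteSpace E]

/-- The symmetric means that are monotone, positively homogeneous, and contractive in each variable
separately. `le_smul` combines monotonicity and homogeneity, and says that the mean is nonexpansive
for the Thompson metric. In `contractive`, the rate `ρ` depends only on a bound `κ` for the
mutual ratios of the entries, and the contraction is expressed through `R - 1` rather than through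
the Thompson distance `log R`. -/
structure IsContractiveMean {k : ℕ} (μ : (Fin k → PosDefOp E) → PosDefOp E) : Prop where
  isMean : IsMean μ
  le_smul : ∀ t : ℝ, 0 < t → ∀ x y : Fin k → PosDefOp E,
    (∀ i, (x i).1 ≤ t • (y i).1) → (μ x).1 ≤ t • (μ y).1
  symmetric : ∀ (σ : Equiv.Perm (Fin k)) x, μ (x ∘ σ) = μ x
  contractive : ∀ κ : ℝ, 1 ≤ κ → ∃ ρ : ℝ, 0 ≤ ρ ∧ ρ < 1 ∧ ∀ R : ℝ, 1 ≤ R →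
    ∀ (x y : Fin k → PosDefOp E) (j : Fin k), (∀ i i', (y i).1 ≤ κ • (y i').1) →
      (x j).1 ≤ R • (y j).1 → (∀ i, i ≠ j → x i ≤ y i) →
        (μ x).1 ≤ (1 + ρ * (R - 1)) • (μ y).1

namespace IsContractiveMean

variable {k : ℕ} {μ : (Fin k → PosDefOp E) → PosDefOp E}

theorem monotone (hμ : IsContractiveMean μ) : Monotone μ := fun x y h => by
  have := hμ.le_smul 1 one_pos x y fun i => by
    rw [one_smul]
    exact h i
  rwa [one_smul] at this

theorem continuous (hμ : IsContractiveMean μ) : Continuous μ := by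
  rw [continuous_iff_continuousAt]
  intro x
  rw [ContinuousAt, tendsto_subtype_rng, Metric.tendsto_nhds]
  intro ε hε
  set R : ℝ := 1 + ε / (3 * (‖(μ x).1‖ + 1)) with hR
  have hR1 : 1 < R := by
    rw [hR, lt_add_iff_pos_right]
    positivity
  have hev : ∀ᶠ y in 𝓝 x, ∀ i, (y i).1 ≤ R • (x i).1 ∧ (x i).1 ≤ R • (y i).1 :=
    eventually_all.2 fun i =>
      (continuous_apply i).continuousAt.eventually ((x i).eventually_le_smul hR1)
  filter_upwards [hev] with y hy
  rw [dist_eq_norm]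
  refine (norm_sub_le_of_le_smul (μ x).2.nonneg hR1.le
    (hμ.le_smul R (by linarith) y x fun i => (hy i).1)
    (hμ.le_smul R (by linarith) x y fun i => (hy i).2)).trans_lt ?_
  rw [hR, add_sub_cancel_left]
  field_simp
  linarith

theorem barycentric_le_smul (hμ : IsContractiveMean μ) {t : ℝ} (ht : 0 < t)
    {x y : Fin (k + 1) → PosDefOp E} {i j : Fin (k + 1)}
    (h : ∀ l, (x (i.succAbove l)).1 ≤ t • (y (j.succAbove l)).1) :
    (barycentric μ x i).1 ≤ t • (barycentric μ y j).1 :=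
  hμ.le_smul t ht _ _ h

/-- One application of the barycentric operator contracts the diameter of a tuple. The entries of
the tuples with `x i` and with `x j` deleted agree, up to a permutation, except for one entry,
which is `x j` in the first tuple and `x i` in the second. -/
theorem barycentric_contract (hμ : IsContractiveMean μ) {ρ R : ℝ} {x : Fin (k + 1) → PosDefOp E}
    (hρ : 0 ≤ ρ) (hR : 1 ≤ R)
    (h : ∀ (y z : Fin k → PosDefOp E) (l : Fin k), (∀ i, z i ∈ Set.range x) →
      (y l).1 ≤ R • (z l).1 → (∀ i, i ≠ l → y i ≤ z i) →
        (μ y).1 ≤ (1 + ρ * (R - 1)) • (μ z).1)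
    (hx : ∀ i j, (x i).1 ≤ R • (x j).1) (i j : Fin (k + 1)) :
    (barycentric μ x i).1 ≤ (1 + ρ * (R - 1)) • (barycentric μ x j).1 := by
  by_cases hij : i = j
  · subst hij
    have h1 : 1 ≤ 1 + ρ * (R - 1) := by nlinarith
    simpa using smul_le_smul_of_nonneg_right h1 (barycentric μ x i).2.nonneg
  · obtain ⟨l, hl⟩ := Fin.exists_succAbove_eq (Ne.symm hij)
    have e : barycentric μ x j = μ (i.removeNth (x ∘ Equiv.swap i j)) := by
      have := congrFun (barycentric_comp_perm hμ.symmetric (Equiv.swap i j) x) i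
      rw [Function.comp_apply, Equiv.swap_apply_left] at this
      exact this.symm
    rw [e]
    refine h (i.removeNth x) _ l (fun m => ⟨_, rfl⟩) ?_ ?_
    · change (x (i.succAbove l)).1 ≤ R • (x (Equiv.swap i j (i.succAbove l))).1
      exact hx _ _
    · intro m hm
      change x (i.succAbove m) ≤ x (Equiv.swap i j (i.succAbove m))
      rw [Equiv.swap_apply_of_ne_of_ne (Fin.succAbove_ne i m)
        fun h' => hm (Fin.succAbove_right_injective (h'.trans hl.symm))]

/-- The powers of the barycentric operator of a contractive mean converge to the diagonal. -/
theorem exists_tendsto_iterate (hμ : IsContractiveMean μ) (x : Fin (k + 1) → PosDefOp E) :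
    ∃ l : PosDefOp E, Tendsto (fun n : ℕ => (barycentric μ)^[n] x) atTop (𝓝 (fun _ => l)) := by
  obtain ⟨κ, hκ, hx⟩ := PosDefOp.exists_forall_le_smul x
  have hκ0 : 0 < κ := by linarith
  obtain ⟨ρ, hρ0, hρ1, hρ⟩ := hμ.contractive κ hκ
  set u : ℕ → Fin (k + 1) → PosDefOp E := fun n => (barycentric μ)^[n] x with hu
  have hsucc : ∀ n, u (n + 1) = barycentric μ (u n) := fun n => Function.iterate_succ_apply' _ _ _
  have hratio : ∀ n i j, (u n i).1 ≤ κ • (u n j).1 := by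
    intro n
    induction n with
    | zero => exact hx
    | succ n ih =>
      rw [hsucc]
      exact fun i j => hμ.barycentric_le_smul hκ0 fun l => ih _ _
  -- The ratios of the entries of `u n` are bounded by `R n`, which tends geometrically to `1`.
  set R : ℕ → ℝ := fun n => 1 + ρ ^ n * (κ - 1) with hRdef
  have hR1 : ∀ n, 1 ≤ R n := fun n =>
    le_add_of_nonneg_right (mul_nonneg (pow_nonneg hρ0 n) (sub_nonneg.2 hκ))
  have hR : ∀ n i j, (u n i).1 ≤ R n • (u n j).1 := by
    intro n
    induction n with
    | zero => simpa [hRdef, hu] using hx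
    | succ n ih =>
      have e : R (n + 1) = 1 + ρ * (R n - 1) := by
        simp only [hRdef]
        ring
      rw [hsucc, e]
      refine hμ.barycentric_contract hρ0 (hR1 n) (fun y z l hz => ?_) ih
      refine hρ (R n) (hR1 n) y z l fun i i' => ?_
      obtain ⟨a, ha⟩ := hz i
      obtain ⟨b, hb⟩ := hz i'
      rw [← ha, ← hb]
      exact hratio n a b
  -- The orbit stays within a fixed Thompson distance of `x 0`, so it is bounded in norm, and its
  -- limit is bounded below by a positive definite operator.
  have hbound : ∀ n i, (u n i).1 ≤ κ • (x 0).1 ∧ (x 0).1 ≤ κ • (u n i).1 := by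
    intro n
    induction n with
    | zero => exact fun i => ⟨hx _ _, hx _ _⟩
    | succ n ih =>
      rw [hsucc]
      intro i
      have h1 := hμ.barycentric_le_smul hκ0 (x := u n) (y := fun _ => x 0) (i := i) (j := i)
        fun l => (ih _).1
      have h2 := hμ.barycentric_le_smul hκ0 (x := fun _ => x 0) (y := u n) (i := i) (j := i)
        fun l => (ih _).2
      rw [barycentric_const hμ.isMean] at h1 h2
      exact ⟨h1, h2⟩
  have hnorm : ∀ n i, ‖(u n i).1‖ ≤ κ * ‖(x 0).1‖ := fun n i => by
    have := CStarAlgebra.norm_le_norm_of_nonneg_of_le (u n i).2.nonneg (hbound n i).1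
    rwa [norm_smul, Real.norm_of_nonneg hκ0.le] at this
  have hdist : ∀ n i (b : PosDefOp E), b.1 ≤ R n • (u n i).1 → (u n i).1 ≤ R n • b.1 →
      ‖b.1 - (u n i).1‖ ≤ 3 * (κ - 1) * (κ * ‖(x 0).1‖) * ρ ^ n := by
    intro n i b h1 h2
    refine (norm_sub_le_of_le_smul (u n i).2.nonneg (hR1 n) h1 h2).trans ?_
    rw [show R n - 1 = ρ ^ n * (κ - 1) by simp [hRdef],
      show 3 * (κ - 1) * (κ * ‖(x 0).1‖) * ρ ^ n = 3 * (ρ ^ n * (κ - 1)) * (κ * ‖(x 0).1‖) by ring]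
    refine mul_le_mul_of_nonneg_left (hnorm n i) ?_
    have := mul_nonneg (pow_nonneg hρ0 n) (sub_nonneg.2 hκ)
    positivity
  have hstep : ∀ n, dist (u n 0).1 (u (n + 1) 0).1 ≤ 3 * (κ - 1) * (κ * ‖(x 0).1‖) * ρ ^ n := by
    intro n
    rw [dist_comm, dist_eq_norm]
    have hR0 : 0 < R n := one_pos.trans_le (hR1 n)
    have h1 := hμ.barycentric_le_smul hR0 (x := u n) (y := fun _ => u n 0) (i := 0) (j := 0)
      fun l => hR n _ _
    have h2 := hμ.barycentric_le_smul hR0 (x := fun _ => u n 0) (y := u n) (i := 0) (j := 0)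
      fun l => hR n _ _
    rw [barycentric_const hμ.isMean] at h1 h2
    rw [hsucc]
    exact hdist n 0 _ h1 h2
  obtain ⟨l, hl⟩ := cauchySeq_tendsto_of_complete (cauchySeq_of_le_geometric ρ _ hρ1 hstep)
  have hxl : (x 0).1 ≤ κ • l :=
    ge_of_tendsto' (hl.const_smul κ) fun n => (hbound n 0).2
  have hlpos : IsStrictlyPositive l := by
    have h1 : IsStrictlyPositive (κ • l) := (x 0).2.of_le hxl
    have h2 := IsStrictlyPositive.smul (inv_pos.2 hκ0) h1
    rwa [smul_smul, inv_mul_cancel₀ hκ0.ne', one_smul] at h2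
  refine ⟨⟨l, hlpos⟩, tendsto_pi_nhds.2 fun i => tendsto_subtype_rng.2 ?_⟩
  have hdiff : Tendsto (fun n => (u n i).1 - (u n 0).1) atTop (𝓝 0) := by
    refine squeeze_zero_norm (fun n => hdist n 0 (u n i) (hR n _ _) (hR n _ _)) ?_
    simpa using (tendsto_pow_atTop_nhds_zero_of_lt_one hρ0 hρ1).const_mul _
  simpa using hdiff.add hl

theorem exists_isBetaExtension (hμ : IsContractiveMean μ) : ∃ ν, IsBetaExtension μ ν := by
  choose ν hν using hμ.exists_tendsto_iterate
  exact ⟨ν, .of_tendsto hμ.isMean hμ.continuous hν⟩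

/-- The contraction rate of the extension is that of the original mean: a single application of the
barycentric operator, under which the extension is invariant, already contracts. -/
theorem of_isBetaExtension (hμ : IsContractiveMean μ) {ν : (Fin (k + 1) → PosDefOp E) → PosDefOp E}
    (h : IsBetaExtension μ ν) : IsContractiveMean ν := by
  have hle : ∀ t : ℝ, 0 < t → ∀ x y : Fin (k + 1) → PosDefOp E,
      (∀ i, (x i).1 ≤ t • (y i).1) → (ν x).1 ≤ t • (ν y).1 := by
    intro t ht x y hxy
    have hiter : ∀ n i, ((barycentric μ)^[n] x i).1 ≤ t • ((barycentric μ)^[n] y i).1 := by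
      intro n
      induction n with
      | zero => exact hxy
      | succ n ih =>
        simp only [Function.iterate_succ_apply']
        exact fun i => hμ.barycentric_le_smul ht fun l => ih _
    have hx := tendsto_subtype_rng.1 (tendsto_pi_nhds.1 (h.tendsto x) 0)
    have hy := tendsto_subtype_rng.1 (tendsto_pi_nhds.1 (h.tendsto y) 0)
    exact le_of_tendsto_of_tendsto' hx (hy.const_smul t) fun n => hiter n 0
  refine ⟨h.isMean_ext, hle, fun σ x => ?_, fun κ hκ => ?_⟩
  · have h1 := tendsto_pi_nhds.1 (h.tendsto (x ∘ σ)) 0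
    simp only [iterate_barycentric_comp_perm hμ.symmetric] at h1
    exact tendsto_nhds_unique h1 (tendsto_pi_nhds.1 (h.tendsto x) (σ 0))
  · obtain ⟨ρ, hρ0, hρ1, hρ⟩ := hμ.contractive κ hκ
    refine ⟨ρ, hρ0, hρ1, fun R hR x y j hy hj hij => ?_⟩
    have ht : 1 ≤ 1 + ρ * (R - 1) :=
      le_add_of_nonneg_right (mul_nonneg hρ0 (sub_nonneg.2 hR))
    rw [← h.apply_barycentric x, ← h.apply_barycentric y]
    refine hle _ (one_pos.trans_le ht) _ _ fun i => ?_
    by_cases hi : i = j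
    · subst hi
      refine PosDefOp.le_smul_of_le (s := 1) ?_ ht
      refine hμ.barycentric_le_smul one_pos fun l => ?_
      rw [one_smul]
      exact hij _ (Fin.succAbove_ne i l)
    · obtain ⟨l, hl⟩ := Fin.exists_succAbove_eq (Ne.symm hi)
      refine hρ R hR _ _ l (fun _ _ => hy _ _) ?_ fun m hm => ?_
      · change (x (i.succAbove l)).1 ≤ R • (y (i.succAbove l)).1
        rwa [hl]
      · exact hij _ fun h' => hm (Fin.succAbove_right_injective (h'.trans hl.symm))

theorem exists_isBetaExtensionFamily {μ : (Fin 2 → PosDefOp E) → PosDefOp E}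
    (hμ : IsContractiveMean μ) :
    ∃ μs : (n : ℕ) → (Fin n → PosDefOp E) → PosDefOp E, IsBetaExtensionFamily μ μs := by
  choose ext hext using fun (k : ℕ)
    (μ : {μ : (Fin k → PosDefOp E) → PosDefOp E // IsContractiveMean μ}) =>
      μ.2.exists_isBetaExtension
  let F : (m : ℕ) → {μ : (Fin (m + 2) → PosDefOp E) → PosDefOp E // IsContractiveMean μ} :=
    fun m => Nat.rec ⟨μ, hμ⟩ (fun m ν => ⟨ext (m + 2) ν, ν.2.of_isBetaExtension (hext _ ν)⟩) m
  -- The entries with `n < 2` are arbitrary.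
  refine ⟨fun n => match n with
    | 0 => fun _ => Classical.arbitrary _
    | 1 => fun _ => Classical.arbitrary _
    | m + 2 => (F m).1, rfl, fun n hn => ?_⟩
  obtain ⟨m, rfl⟩ := Nat.exists_eq_add_of_le' hn
  exact hext _ (F m)

end IsContractiveMean

theorem IsBetaExtensionFamily.monotone {μ : (Fin 2 → PosDefOp E) → PosDefOp E}
    {μs : (n : ℕ) → (Fin n → PosDefOp E) → PosDefOp E} (h : IsBetaExtensionFamily μ μs)
    (hμ : Monotone μ) {n : ℕ} (hn : 2 ≤ n) : Monotone (μs n) := by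
  induction n, hn using Nat.le_induction with
  | base => rwa [h.two]
  | succ n hn ih =>
    exact fun x y hxy =>
      (h.extends_succ n hn).le_of_le (h.extends_succ n hn) le_rfl ih hxy

theorem IsBetaExtensionFamily.le_of_le {μ μ' : (Fin 2 → PosDefOp E) → PosDefOp E}
    {μs μs' : (n : ℕ) → (Fin n → PosDefOp E) → PosDefOp E} (h : IsBetaExtensionFamily μ μs)
    (h' : IsBetaExtensionFamily μ' μs') (hle : μ ≤ μ') (hμ' : Monotone μ') {n : ℕ} (hn : 2 ≤ n) :
    μs n ≤ μs' n := by
  induction n, hn using Nat.le_induction with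
  | base => rwa [h.two, h'.two]
  | succ n hn ih =>
    exact fun x => (h.extends_succ n hn).le_of_le (h'.extends_succ n hn) ih
      (h'.monotone hμ' hn) le_rfl

end Extension

/-! ### Operator means by functional calculus, and the geometric mean -/

section FunctionalCalculus

variable {E : Type*} [NormedAddCommGroup E] [InnerProductSpace ℂ E] [CompleteSpace E]
variable {A B : E →L[ℂ] E}

theorem rpow_half_mul_rpow_half (hA : IsStrictlyPositive A) :
    A ^ (1 / 2 : ℝ) * A ^ (1 / 2 : ℝ) = A := by
  rw [← CFC.rpow_add hA.isUnit]
  norm_num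
  exact CFC.rpow_one A hA.nonneg

/-- The operator `A^{-1/2} B A^{-1/2}` to which the functional calculus is applied. -/
theorem isStrictlyPositive_conj_rpow (hA : IsStrictlyPositive A) (hB : IsStrictlyPositive B) :
    IsStrictlyPositive (A ^ (-(1 / 2) : ℝ) * B * A ^ (-(1 / 2) : ℝ)) :=
  IsStrictlyPositive.conjugate_of_isUnit_of_isSelfAdjoint _ _ (hA.rpow A _).isUnit
    (hA.rpow A _).isSelfAdjoint hB

theorem continuousOn_spectrum_conj {f : ℝ → ℝ} (hf : ContinuousOn f (Set.Ioi 0))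
    (hA : IsStrictlyPositive A) (hB : IsStrictlyPositive B) :
    ContinuousOn f (spectrum ℝ (A ^ (-(1 / 2) : ℝ) * B * A ^ (-(1 / 2) : ℝ))) :=
  hf.mono fun _ hx => (isStrictlyPositive_conj_rpow hA hB).spectrum_pos hx

theorem meanOfFun_congr {f g : ℝ → ℝ} (h : ∀ x, 0 < x → f x = g x) (hA : IsStrictlyPositive A)
    (hB : IsStrictlyPositive B) : meanOfFun f A B = meanOfFun g A B := by
  unfold meanOfFun
  rw [cfc_congr fun x hx => h x ((isStrictlyPositive_conj_rpow hA hB).spectrum_pos hx)]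

theorem meanOfFun_mono {f g : ℝ → ℝ} (hf : ContinuousOn f (Set.Ioi 0))
    (hg : ContinuousOn g (Set.Ioi 0)) (h : ∀ x, 0 < x → f x ≤ g x) (hA : IsStrictlyPositive A)
    (hB : IsStrictlyPositive B) : meanOfFun f A B ≤ meanOfFun g A B :=
  conjugate_le_conjugate_of_nonneg
    (cfc_mono (fun x hx => h x ((isStrictlyPositive_conj_rpow hA hB).spectrum_pos hx))
      (continuousOn_spectrum_conj hf hA hB) (continuousOn_spectrum_conj hg hA hB))
    (hA.rpow A _).nonneg

theorem meanOfFun_one (hA : IsStrictlyPositive A) (hB : IsStrictlyPositive B) :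
    meanOfFun (fun _ => 1) A B = A := by
  unfold meanOfFun
  rw [cfc_const_one ℝ _ (isStrictlyPositive_conj_rpow hA hB).isSelfAdjoint, mul_one,
    rpow_half_mul_rpow_half hA]

theorem conj_rpow_conj_rpow_neg (hA : IsStrictlyPositive A) (C : E →L[ℂ] E) :
    A ^ (1 / 2 : ℝ) * (A ^ (-(1 / 2) : ℝ) * C * A ^ (-(1 / 2) : ℝ)) * A ^ (1 / 2 : ℝ) = C := by
  have h1 := CFC.rpow_mul_rpow_neg (a := A) (1 / 2) hA
  have h2 := CFC.rpow_neg_mul_rpow (a := A) (1 / 2) hA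
  calc _ = (A ^ (1 / 2 : ℝ) * A ^ (-(1 / 2) : ℝ)) * C * (A ^ (-(1 / 2) : ℝ) * A ^ (1 / 2 : ℝ)) := by
        simp only [mul_assoc]
    _ = C := by rw [h1, h2, one_mul, mul_one]

theorem meanOfFun_id (hA : IsStrictlyPositive A) (hB : IsStrictlyPositive B) :
    meanOfFun (fun x => x) A B = B := by
  unfold meanOfFun
  rw [cfc_id' ℝ _ (isStrictlyPositive_conj_rpow hA hB).isSelfAdjoint, conj_rpow_conj_rpow_neg hA]

theorem meanOfFun_add {f g : ℝ → ℝ} (hf : ContinuousOn f (Set.Ioi 0))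
    (hg : ContinuousOn g (Set.Ioi 0)) (hA : IsStrictlyPositive A) (hB : IsStrictlyPositive B) :
    meanOfFun (fun x => f x + g x) A B = meanOfFun f A B + meanOfFun g A B := by
  unfold meanOfFun
  rw [cfc_add _ f g (continuousOn_spectrum_conj hf hA hB) (continuousOn_spectrum_conj hg hA hB),
    mul_add, add_mul]

theorem meanOfFun_const_mul {f : ℝ → ℝ} (c : ℝ) (hf : ContinuousOn f (Set.Ioi 0))
    (hA : IsStrictlyPositive A) (hB : IsStrictlyPositive B) :
    meanOfFun (fun x => c * f x) A B = c • meanOfFun f A B := by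
  unfold meanOfFun
  rw [cfc_const_mul c f _ (continuousOn_spectrum_conj hf hA hB), mul_smul_comm, smul_mul_assoc]

/-- On the diagonal, a mean of functional calculus takes the value `f 1 • A`. -/
theorem meanOfFun_self {f : ℝ → ℝ} (hA : IsStrictlyPositive A) :
    meanOfFun f A A = f 1 • A := by
  have hX : A ^ (-(1 / 2) : ℝ) * A * A ^ (-(1 / 2) : ℝ) = 1 := CFC.conjugate_rpow_neg_one_half A hA
  unfold meanOfFun
  rw [hX, cfc_apply_one, Algebra.algebraMap_eq_smul_one, mul_smul_comm, smul_mul_assoc, mul_one,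
    rpow_half_mul_rpow_half hA]

theorem cfc_real_sqrt {X : E →L[ℂ] E} (hX : 0 ≤ X) : cfc Real.sqrt X = CFC.sqrt X := by
  rw [CFC.sqrt_eq_real_sqrt X hX, cfcₙ_eq_cfc]

/-- The geometric mean `P # Q` is the only positive solution `G` of the Riccati equation
`G P⁻¹ G = Q`. -/
theorem eq_meanOfFun_sqrt_of_riccati {P P' Q G : E →L[ℂ] E} (hP : IsStrictlyPositive P)
    (hPP' : P * P' = 1) (hG : 0 ≤ G) (hQ : IsStrictlyPositive Q) (h : G * P' * G = Q) :
    meanOfFun Real.sqrt P Q = G := by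
  have hX := (isStrictlyPositive_conj_rpow hP hQ).nonneg
  have hT : IsSelfAdjoint (P ^ (-(1 / 2) : ℝ)) := (hP.rpow P _).isSelfAdjoint
  have h1 := CFC.rpow_neg_mul_rpow (a := P) (1 / 2) hP
  have hTT : P ^ (-(1 / 2) : ℝ) * P ^ (-(1 / 2) : ℝ) = P' := by
    calc _ = P ^ (-(1 / 2) : ℝ) * P ^ (-(1 / 2) : ℝ) * (P * P') := by rw [hPP', mul_one]
      _ = P ^ (-(1 / 2) : ℝ) * (P ^ (-(1 / 2) : ℝ) * P ^ (1 / 2 : ℝ)) * P ^ (1 / 2 : ℝ) * P' := by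
        nth_rewrite 3 [← rpow_half_mul_rpow_half hP]
        simp only [mul_assoc]
      _ = P' := by rw [h1, mul_one, h1, one_mul]
  have hG' : 0 ≤ P ^ (-(1 / 2) : ℝ) * G * P ^ (-(1 / 2) : ℝ) := hT.conjugate_nonneg hG
  have key : CFC.sqrt (P ^ (-(1 / 2) : ℝ) * Q * P ^ (-(1 / 2) : ℝ)) =
      P ^ (-(1 / 2) : ℝ) * G * P ^ (-(1 / 2) : ℝ) := by
    rw [CFC.sqrt_eq_iff _ _ hX hG', ← h, ← hTT]
    simp only [mul_assoc]
  unfold meanOfFun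
  rw [cfc_real_sqrt hX, key, conj_rpow_conj_rpow_neg hP]

/-- The geometric mean of `A^{1/2} p(X) A^{1/2}` and `A^{1/2} q(X) A^{1/2}` is computed on the
commuting operators `p(X)` and `q(X)`. -/
theorem meanOfFun_sqrt_meanOfFun {p q : ℝ → ℝ} (hp : ContinuousOn p (Set.Ioi 0))
    (hq : ContinuousOn q (Set.Ioi 0)) (hp0 : ∀ x, 0 < x → 0 < p x) (hq0 : ∀ x, 0 < x → 0 < q x)
    (hA : IsStrictlyPositive A) (hB : IsStrictlyPositive B) :
    meanOfFun Real.sqrt (meanOfFun p A B) (meanOfFun q A B) =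
      meanOfFun (fun x => √(p x * q x)) A B := by
  have hX := isStrictlyPositive_conj_rpow hA hB
  have hr : ContinuousOn (fun x => √(p x * q x)) (Set.Ioi 0) := (hp.mul hq).sqrt
  have hi : ContinuousOn (fun x => (p x)⁻¹) (Set.Ioi 0) := hp.inv₀ fun x hx => (hp0 x hx).ne'
  have hST := CFC.rpow_mul_rpow_neg (a := A) (1 / 2) hA
  have hTS := CFC.rpow_neg_mul_rpow (a := A) (1 / 2) hA
  have cp := continuousOn_spectrum_conj hp hA hB
  have cr := continuousOn_spectrum_conj hr hA hB
  have ci := continuousOn_spectrum_conj hi hA hB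
  have hcancel : ∀ C, A ^ (1 / 2 : ℝ) * (A ^ (-(1 / 2) : ℝ) * C) = C := fun C => by
    rw [← mul_assoc, hST, one_mul]
  have hcancel' : ∀ C, A ^ (-(1 / 2) : ℝ) * (A ^ (1 / 2 : ℝ) * C) = C := fun C => by
    rw [← mul_assoc, hTS, one_mul]
  refine eq_meanOfFun_sqrt_of_riccati (isStrictlyPositive_meanOfFun hp hp0 hA hB)
    (P' := A ^ (-(1 / 2) : ℝ) *
      cfc (fun x => (p x)⁻¹) (A ^ (-(1 / 2) : ℝ) * B * A ^ (-(1 / 2) : ℝ)) * A ^ (-(1 / 2) : ℝ))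
    ?_ ?_ (isStrictlyPositive_meanOfFun hq hq0 hA hB) ?_
  · have h1 : cfc p (A ^ (-(1 / 2) : ℝ) * B * A ^ (-(1 / 2) : ℝ)) *
        cfc (fun x => (p x)⁻¹) (A ^ (-(1 / 2) : ℝ) * B * A ^ (-(1 / 2) : ℝ)) = 1 := by
      rw [← cfc_mul _ _ _ cp ci, ← cfc_const_one ℝ _ hX.isSelfAdjoint]
      exact cfc_congr fun x hx => mul_inv_cancel₀ (hp0 x (hX.spectrum_pos hx)).ne'
    unfold meanOfFun
    simp only [mul_assoc, hcancel]
    simp only [← mul_assoc] at h1 ⊢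
    rw [mul_assoc (A ^ (1 / 2 : ℝ)), h1, mul_one, hST]
  · exact (isStrictlyPositive_meanOfFun hr
      (fun x hx => Real.sqrt_pos.2 (mul_pos (hp0 x hx) (hq0 x hx))) hA hB).nonneg
  · have h2 : cfc (fun x => √(p x * q x)) (A ^ (-(1 / 2) : ℝ) * B * A ^ (-(1 / 2) : ℝ)) *
        cfc (fun x => (p x)⁻¹) (A ^ (-(1 / 2) : ℝ) * B * A ^ (-(1 / 2) : ℝ)) *
        cfc (fun x => √(p x * q x)) (A ^ (-(1 / 2) : ℝ) * B * A ^ (-(1 / 2) : ℝ)) =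
        cfc q (A ^ (-(1 / 2) : ℝ) * B * A ^ (-(1 / 2) : ℝ)) := by
      rw [← cfc_mul _ _ _ cr ci, 
        ← cfc_mul (fun x => √(p x * q x) * (p x)⁻¹) _ _ (cr.mul ci) cr]
      refine cfc_congr fun x hx => ?_
      have hx0 := hX.spectrum_pos hx
      have h := Real.mul_self_sqrt (mul_pos (hp0 x hx0) (hq0 x hx0)).le
      have hne := (hp0 x hx0).ne'
      rw [mul_right_comm, h]
      field_simp
    unfold meanOfFun
    rw [← h2]
    simp only [mul_assoc, hcancel, hcancel']

end FunctionalCalculus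

section GeometricMean

variable {E : Type*} [NormedAddCommGroup E] [InnerProductSpace ℂ E] [CompleteSpace E]

theorem operatorMean_isMean {f : ℝ → ℝ} (hc : ContinuousOn f (Set.Ioi 0))
    (hpos : ∀ x, 0 < x → 0 < f x) (h1 : f 1 = 1) :
    IsMean (operatorMean (E := E) f hc hpos) := fun A =>
  Subtype.ext (by
    change meanOfFun f A.1 A.1 = A.1
    rw [meanOfFun_self A.2, h1, one_smul])

theorem geomMean_isMean : IsMean (geomMean (E := E)) :=
  operatorMean_isMean _ _ Real.sqrt_one

theorem arithMean_isMean : IsMean (arithMean (E := E)) := fun A =>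
  Subtype.ext (by
    change (1 / 2 : ℝ) • (A.1 + A.1) = A.1
    rw [← two_smul ℝ A.1, smul_smul]
    norm_num)

theorem geomMean_comm (A B : PosDefOp E) : geomMean ![A, B] = geomMean ![B, A] := by
  refine Subtype.ext ?_
  change meanOfFun Real.sqrt A.1 B.1 = meanOfFun Real.sqrt B.1 A.1
  -- `B = A^{1/2} X A^{1/2}` and `A = A^{1/2} 1 A^{1/2}`, so `B # A = A^{1/2} √X A^{1/2}`.
  have h := meanOfFun_sqrt_meanOfFun (p := fun x => x) (q := fun _ => 1) continuousOn_id
    continuousOn_const (fun _ => id) (fun _ _ => one_pos) A.2 B.2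
  rw [meanOfFun_id A.2 B.2, meanOfFun_one A.2 B.2] at h
  simpa using h.symm

theorem arithMean_comm (A B : PosDefOp E) : arithMean ![A, B] = arithMean ![B, A] :=
  Subtype.ext (congrArg (fun C => (1 / 2 : ℝ) • C) (add_comm A.1 B.1))

theorem meanOfFun_sqrt_le_right (A B B' : PosDefOp E) {s : ℝ} (hs : 0 ≤ s) (h : B.1 ≤ s • B'.1) :
    meanOfFun Real.sqrt A.1 B.1 ≤ √s • meanOfFun Real.sqrt A.1 B'.1 := by
  have hT := (A.2.rpow A.1 (-(1 / 2))).nonneg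
  have hX := (isStrictlyPositive_conj_rpow A.2 B.2).nonneg
  have hX' := (isStrictlyPositive_conj_rpow A.2 B'.2).nonneg
  have h1 := conjugate_le_conjugate_of_nonneg h hT
  rw [mul_smul_comm, smul_mul_assoc] at h1
  have h2 := CFC.sqrt_le_sqrt _ _ h1
  have h3 : CFC.sqrt (s • (A.1 ^ (-(1 / 2) : ℝ) * B'.1 * A.1 ^ (-(1 / 2) : ℝ))) =
      √s • CFC.sqrt (A.1 ^ (-(1 / 2) : ℝ) * B'.1 * A.1 ^ (-(1 / 2) : ℝ)) := by
    rw [CFC.sqrt_eq_iff _ _ (smul_nonneg hs hX')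
      (smul_nonneg (Real.sqrt_nonneg s) (CFC.sqrt_nonneg _)), smul_mul_smul_comm,
      Real.mul_self_sqrt hs, CFC.sqrt_mul_sqrt_self _ hX']
  rw [h3] at h2
  have h4 := conjugate_le_conjugate_of_nonneg h2 (A.2.rpow A.1 (1 / 2)).nonneg
  rw [mul_smul_comm, smul_mul_assoc] at h4
  unfold meanOfFun
  rwa [cfc_real_sqrt hX, cfc_real_sqrt hX']

/-- The geometric mean is monotone in both variables, and homogeneous of degree `1 / 2` in each. -/
theorem geomMean_le_smul {A A' B B' : PosDefOp E} {r s : ℝ} (hr : 0 ≤ r) (hs : 0 ≤ s)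
    (hA : A.1 ≤ r • A'.1) (hB : B.1 ≤ s • B'.1) :
    (geomMean ![A, B]).1 ≤ √(r * s) • (geomMean ![A', B']).1 := by
  have h1 : (geomMean ![A, B]).1 ≤ √s • (geomMean ![A, B']).1 :=
    meanOfFun_sqrt_le_right A B B' hs hB
  have h2 : (geomMean ![B', A]).1 ≤ √r • (geomMean ![B', A']).1 :=
    meanOfFun_sqrt_le_right B' A A' hr hA
  rw [geomMean_comm B' A, geomMean_comm B' A'] at h2
  rw [mul_comm r s, Real.sqrt_mul hs, mul_smul]
  exact h1.trans (smul_le_smul_of_nonneg_left h2 (Real.sqrt_nonneg s))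

theorem geomMean_le_smul_of_le {A A' B B' : PosDefOp E} {t : ℝ} (ht : 0 ≤ t)
    (hA : A.1 ≤ t • A'.1) (hB : B.1 ≤ t • B'.1) :
    (geomMean ![A, B]).1 ≤ t • (geomMean ![A', B']).1 := by
  have := geomMean_le_smul ht ht hA hB
  rwa [Real.sqrt_mul_self ht] at this

theorem arithMean_le_smul_of_le {A A' B B' : PosDefOp E} {t : ℝ}
    (hA : A.1 ≤ t • A'.1) (hB : B.1 ≤ t • B'.1) :
    (arithMean ![A, B]).1 ≤ t • (arithMean ![A', B']).1 := by
  change (1 / 2 : ℝ) • (A.1 + B.1) ≤ t • (1 / 2 : ℝ) • (A'.1 + B'.1)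
  rw [smul_comm, smul_add t]
  exact smul_le_smul_of_nonneg_left (add_le_add hA hB) (by norm_num)

theorem arithMean_eq_meanOfFun {A B : E →L[ℂ] E} {p q : ℝ → ℝ} (hp : ContinuousOn p (Set.Ioi 0))
    (hq : ContinuousOn q (Set.Ioi 0)) (hA : IsStrictlyPositive A) (hB : IsStrictlyPositive B)
    {x : Fin 2 → PosDefOp E} (h0 : (x 0).1 = meanOfFun p A B) (h1 : (x 1).1 = meanOfFun q A B) :
    (arithMean x).1 = meanOfFun (fun t => (p t + q t) / 2) A B := by
  change (1 / 2 : ℝ) • ((x 0).1 + (x 1).1) = _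
  rw [h0, h1, ← meanOfFun_add hp hq hA hB, 
    ← meanOfFun_const_mul (f := fun t => p t + q t) _ (hp.add hq) hA hB]
  exact meanOfFun_congr (fun t _ => by ring) hA hB

theorem geomMean_eq_meanOfFun {A B : E →L[ℂ] E} {p q : ℝ → ℝ} (hp : ContinuousOn p (Set.Ioi 0))
    (hq : ContinuousOn q (Set.Ioi 0)) (hp0 : ∀ x, 0 < x → 0 < p x) (hq0 : ∀ x, 0 < x → 0 < q x)
    (hA : IsStrictlyPositive A) (hB : IsStrictlyPositive B)
    {x : Fin 2 → PosDefOp E} (h0 : (x 0).1 = meanOfFun p A B) (h1 : (x 1).1 = meanOfFun q A B) :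
    (geomMean x).1 = meanOfFun (fun t => √(p t * q t)) A B := by
  change meanOfFun Real.sqrt (x 0).1 (x 1).1 = _
  rw [h0, h1, meanOfFun_sqrt_meanOfFun hp hq hp0 hq0 hA hB]

theorem geomMean_le_arithMean (x : Fin 2 → PosDefOp E) : geomMean x ≤ arithMean x := by
  change (geomMean x).1 ≤ (arithMean x).1
  rw [arithMean_eq_meanOfFun (p := fun _ => 1) (q := fun t => t) continuousOn_const continuousOn_id
    (x 0).2 (x 1).2 (meanOfFun_one (x 0).2 (x 1).2).symm (meanOfFun_id (x 0).2 (x 1).2).symm]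
  refine meanOfFun_mono Real.continuous_sqrt.continuousOn (by fun_prop) (fun t ht => ?_)
    (x 0).2 (x 1).2
  nlinarith [sq_nonneg (√t - 1), Real.sq_sqrt ht.le]

theorem le_geomMean {A B : PosDefOp E} (h : A ≤ B) : A ≤ geomMean ![A, B] := by
  have h1 := geomMean_le_smul_of_le (A := A) (A' := A) (B := A) (B' := B) zero_le_one
    (by rw [one_smul]) (by rw [one_smul]; exact h)
  have e : ![A, A] = fun _ => A := by
    funext i
    fin_cases i <;> rfl
  rwa [e, geomMean_isMean, one_smul] at h1

end GeometricMean

/-! ### Contractivity of means of two variables -/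

section TwoVariableMeans

variable {E : Type*} [NormedAddCommGroup E] [InnerProductSpace ℂ E] [CompleteSpace E]

theorem eq_vecCons_two {X : Type*} (x : Fin 2 → X) : x = ![x 0, x 1] := by
  funext i
  fin_cases i <;> rfl

theorem const_eq_vecCons_two {X : Type*} (a : X) : (fun _ : Fin 2 => a) = ![a, a] :=
  eq_vecCons_two _

/-- For a symmetric mean of two variables, contractivity needs to be checked in the first variable
only. -/
theorem IsContractiveMean.of_two {μ : (Fin 2 → PosDefOp E) → PosDefOp E} (hμ : IsMean μ)
    (comm : ∀ A B, μ ![A, B] = μ ![B, A])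
    (le_smul : ∀ t : ℝ, 0 < t → ∀ A A' B B' : PosDefOp E, A.1 ≤ t • A'.1 → B.1 ≤ t • B'.1 →
      (μ ![A, B]).1 ≤ t • (μ ![A', B']).1)
    (contr : ∀ κ : ℝ, 1 ≤ κ → ∃ ρ : ℝ, 0 ≤ ρ ∧ ρ < 1 ∧ ∀ R : ℝ, 1 ≤ R → ∀ A A' B : PosDefOp E,
      A'.1 ≤ κ • B.1 → B.1 ≤ κ • A'.1 → A.1 ≤ R • A'.1 →
        (μ ![A, B]).1 ≤ (1 + ρ * (R - 1)) • (μ ![A', B]).1) :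
    IsContractiveMean μ where
  isMean := hμ
  le_smul t ht x y h := by
    rw [eq_vecCons_two x, eq_vecCons_two y]
    exact le_smul t ht _ _ _ _ (h 0) (h 1)
  symmetric σ x := by
    rw [eq_vecCons_two (x ∘ σ), eq_vecCons_two x]
    have hne : σ 0 ≠ σ 1 := σ.injective.ne (by decide)
    have h : σ 0 = 0 ∧ σ 1 = 1 ∨ σ 0 = 1 ∧ σ 1 = 0 := by
      generalize σ 0 = a at hne
      generalize σ 1 = b at hne
      revert a b
      decide
    rcases h with ⟨h0, h1⟩ | ⟨h0, h1⟩
    · simp [h0, h1]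
    · simpa [h0, h1] using comm (x 1) (x 0)
  contractive κ hκ := by
    obtain ⟨ρ, hρ0, hρ1, hρ⟩ := contr κ hκ
    have key : ∀ R : ℝ, 1 ≤ R → ∀ A A' B B' : PosDefOp E, A'.1 ≤ κ • B'.1 → B'.1 ≤ κ • A'.1 →
        A.1 ≤ R • A'.1 → B ≤ B' → (μ ![A, B]).1 ≤ (1 + ρ * (R - 1)) • (μ ![A', B']).1 := by
      intro R hR A A' B B' h1 h2 h3 h4
      refine le_trans ?_ (hρ R hR A A' B' h1 h2 h3)
      have := le_smul 1 one_pos A A B B' (by rw [one_smul]) (by rw [one_smul]; exact h4)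
      rwa [one_smul] at this
    refine ⟨ρ, hρ0, hρ1, fun R hR x y j hy hj hle => ?_⟩
    rw [eq_vecCons_two x, eq_vecCons_two y]
    fin_cases j
    · exact key R hR _ _ _ _ (hy 0 1) (hy 1 0) hj (hle 1 (by decide))
    · rw [comm (x 0), comm (y 0)]
      exact key R hR _ _ _ _ (hy 1 0) (hy 0 1) hj (hle 0 (by decide))

/-- If `a ≤ κ b`, then multiplying `a` by at most `R` and `b` by at most `(1 + R) / 2` increases
`a + b` by at most a factor `1 + ρ (R - 1)`, where `ρ < 1` depends on `κ` only. -/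
theorem half_smul_add_le {a b : E →L[ℂ] E} {κ ρ r s R : ℝ} (hκ : a ≤ κ • b) (hR : 1 ≤ R)
    (hb : 0 ≤ b) (hρ1 : ρ ≤ 1) (hr : r ≤ R) (ha : 0 ≤ a) (hs : s ≤ 1 + (R - 1) / 2)
    (hρ : (1 - ρ) * κ ≤ ρ - 1 / 2) : r • a + s • b ≤ (1 + ρ * (R - 1)) • (a + b) := by
  have h1 : r • a ≤ (1 + ρ * (R - 1)) • a + ((1 - ρ) * (R - 1) * κ) • b := by
    have h2 : ((1 - ρ) * (R - 1)) • a ≤ ((1 - ρ) * (R - 1) * κ) • b := by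
      rw [mul_smul _ κ]
      exact smul_le_smul_of_nonneg_left hκ (mul_nonneg (by linarith) (by linarith))
    calc r • a ≤ R • a := smul_le_smul_of_nonneg_right hr ha
      _ = (1 + ρ * (R - 1)) • a + ((1 - ρ) * (R - 1)) • a := by
        rw [← add_smul]
        congr 1
        ring
      _ ≤ _ := by gcongr
  have h3 : s • b + ((1 - ρ) * (R - 1) * κ) • b ≤ (1 + ρ * (R - 1)) • b := by
    rw [← add_smul]
    refine smul_le_smul_of_nonneg_right ?_ hb
    nlinarith [mul_le_mul_of_nonneg_right hρ (sub_nonneg.2 hR)]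
  calc r • a + s • b ≤ (1 + ρ * (R - 1)) • a + ((1 - ρ) * (R - 1) * κ) • b + s • b := by gcongr
    _ = (1 + ρ * (R - 1)) • a + (s • b + ((1 - ρ) * (R - 1) * κ) • b) := by abel
    _ ≤ (1 + ρ * (R - 1)) • a + (1 + ρ * (R - 1)) • b := by gcongr
    _ = _ := (smul_add _ _ _).symm

/-- The rate `ρ = (κ + 1/2) / (κ + 1)` at which the arithmetic mean contracts on tuples whose
entries have mutual ratios at most `κ`. -/
theorem exists_contraction_rate {κ : ℝ} (hκ : 1 ≤ κ) :
    ∃ ρ : ℝ, 1 / 2 ≤ ρ ∧ ρ < 1 ∧ (1 - ρ) * κ ≤ ρ - 1 / 2 := by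
  have h : 0 < κ + 1 := by linarith
  refine ⟨(κ + 1 / 2) / (κ + 1), ?_, ?_, le_of_eq ?_⟩
  · rw [le_div_iff₀ h]
    linarith
  · rw [div_lt_one h]
    linarith
  · field_simp
    ring

theorem sqrt_le_one_add_half {R : ℝ} (hR : 0 ≤ R) : √R ≤ 1 + (R - 1) / 2 := by
  nlinarith [sq_nonneg (√R - 1), Real.sq_sqrt hR]

theorem geomMean_le_sqrt_smul_left {A A' B : PosDefOp E} {R : ℝ} (hR : 0 ≤ R)
    (h : A.1 ≤ R • A'.1) : (geomMean ![A, B]).1 ≤ √R • (geomMean ![A', B]).1 := by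
  have := geomMean_le_smul (B := B) (B' := B) hR zero_le_one h (by rw [one_smul])
  rwa [mul_one] at this

end TwoVariableMeans

/-! ### The logarithmic mean of operators -/

section LogMean

variable {E : Type*} [NormedAddCommGroup E] [InnerProductSpace ℂ E] [CompleteSpace E]

/-- The trapezoidal approximations of the logarithmic mean of operators, which only involve
geometric and arithmetic means. -/
noncomputable def trapezoid : ℕ → PosDefOp E → PosDefOp E → PosDefOp E
  | 0, A, B => arithMean ![A, B]
  | n + 1, A, B =>
    arithMean ![trapezoid n A (geomMean ![A, B]), trapezoid n (geomMean ![A, B]) B]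

theorem trapezoid_le_smul (n : ℕ) {t : ℝ} (ht : 0 < t) {A A' B B' : PosDefOp E}
    (hA : A.1 ≤ t • A'.1) (hB : B.1 ≤ t • B'.1) :
    (trapezoid n A B).1 ≤ t • (trapezoid n A' B').1 := by
  induction n generalizing A A' B B' with
  | zero => exact arithMean_le_smul_of_le hA hB
  | succ n ih =>
    have hG := geomMean_le_smul_of_le ht.le hA hB
    exact arithMean_le_smul_of_le (ih hA hG) (ih hG hB)

theorem trapezoid_comm (n : ℕ) (A B : PosDefOp E) : trapezoid n A B = trapezoid n B A := by
  induction n generalizing A B with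
  | zero => exact arithMean_comm A B
  | succ n ih => rw [trapezoid, trapezoid, arithMean_comm, geomMean_comm B A, ih A, ih _ B]

theorem continuousOn_realTrapezoid (n : ℕ) {p q : ℝ → ℝ} {s : Set ℝ} (hp : ContinuousOn p s)
    (hq : ContinuousOn q s) : ContinuousOn (fun t => realTrapezoid n (p t) (q t)) s := by
  induction n generalizing p q with
  | zero => exact (hp.add hq).div_const 2
  | succ n ih => exact ((ih hp (hp.mul hq).sqrt).add (ih (hp.mul hq).sqrt hq)).div_const 2

theorem trapezoid_eq_meanOfFun (n : ℕ) {A B : E →L[ℂ] E} (hA : IsStrictlyPositive A)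
    (hB : IsStrictlyPositive B) {p q : ℝ → ℝ} (hp : ContinuousOn p (Set.Ioi 0))
    (hq : ContinuousOn q (Set.Ioi 0)) (hp0 : ∀ x, 0 < x → 0 < p x) (hq0 : ∀ x, 0 < x → 0 < q x)
    {P Q : PosDefOp E} (hP : P.1 = meanOfFun p A B) (hQ : Q.1 = meanOfFun q A B) :
    (trapezoid n P Q).1 = meanOfFun (fun t => realTrapezoid n (p t) (q t)) A B := by
  induction n generalizing p q P Q with
  | zero => exact arithMean_eq_meanOfFun hp hq hA hB hP hQ
  | succ n ih =>
    have hG := geomMean_eq_meanOfFun (x := ![P, Q]) hp hq hp0 hq0 hA hB hP hQ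
    have hr : ContinuousOn (fun x => √(p x * q x)) (Set.Ioi 0) := (hp.mul hq).sqrt
    have hr0 : ∀ x, 0 < x → 0 < √(p x * q x) := fun x hx =>
      Real.sqrt_pos.2 (mul_pos (hp0 x hx) (hq0 x hx))
    exact arithMean_eq_meanOfFun (continuousOn_realTrapezoid n hp hr)
      (continuousOn_realTrapezoid n hr hq) hA hB (ih hp hr hp0 hr0 hP hG) (ih hr hq hr0 hq0 hG hQ)

theorem tendsto_trapezoid (A B : PosDefOp E) :
    Tendsto (fun n => (trapezoid n A B).1) atTop (𝓝 (logMean ![A, B]).1) := by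
  have hT : ∀ n, (trapezoid n A B).1 = meanOfFun (fun t => realTrapezoid n 1 t) A.1 B.1 :=
    fun n => trapezoid_eq_meanOfFun n A.2 B.2 (p := fun _ => 1) (q := fun t => t)
      continuousOn_const continuousOn_id (fun _ _ => one_pos) (fun _ => id)
      (meanOfFun_one A.2 B.2).symm (meanOfFun_id A.2 B.2).symm
  have hcont : ∀ n, ContinuousOn (fun t => realTrapezoid n 1 t) (Set.Ioi 0) := fun n =>
    continuousOn_realTrapezoid n (p := fun _ => 1) (q := fun t => t) continuousOn_const
      continuousOn_id
  have hlow : ∀ n, (logMean ![A, B]).1 ≤ (trapezoid n A B).1 := fun n => by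
    rw [hT]
    exact meanOfFun_mono continuousOn_realLogMean_one (hcont n)
      (fun t ht => realLogMean_le_realTrapezoid n one_pos ht) A.2 B.2
  have hup : ∀ n, (trapezoid n A B).1 - (logMean ![A, B]).1 ≤
      ((1 / 2 : ℝ) ^ n) • (arithMean ![A, B]).1 := fun n => by
    -- The scalar error bound `2⁻ⁿ (1 + t) / 2` represents `2⁻ⁿ` times the arithmetic mean.
    have hlin : ContinuousOn (fun t : ℝ => (1 + t) / 2) (Set.Ioi 0) := by fun_prop
    have h := meanOfFun_mono (hcont n)
      (continuousOn_realLogMean_one.add (hlin.const_smul ((1 / 2 : ℝ) ^ n)))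
      (fun t ht => realTrapezoid_le n one_pos ht) A.2 B.2
    have e := meanOfFun_add continuousOn_realLogMean_one (hlin.const_smul ((1 / 2 : ℝ) ^ n)) A.2 B.2
    have e' := meanOfFun_const_mul ((1 / 2 : ℝ) ^ n) hlin A.2 B.2
    have e'' := arithMean_eq_meanOfFun (x := ![A, B]) (p := fun _ => 1) (q := fun t => t)
      continuousOn_const continuousOn_id A.2 B.2
      (meanOfFun_one A.2 B.2).symm (meanOfFun_id A.2 B.2).symm
    rw [hT, e'', ← e', sub_le_iff_le_add']
    exact h.trans e.le
  have hdiff : Tendsto (fun n => (trapezoid n A B).1 - (logMean ![A, B]).1) atTop (𝓝 0) := by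
    refine squeeze_zero_norm (a := fun n => (1 / 2 : ℝ) ^ n * ‖(arithMean ![A, B]).1‖)
      (fun n => ?_) ?_
    · have := CStarAlgebra.norm_le_norm_of_nonneg_of_le (sub_nonneg.2 (hlow n)) (hup n)
      rwa [norm_smul, Real.norm_of_nonneg (by positivity)] at this
    · simpa using (tendsto_pow_atTop_nhds_zero_of_lt_one (r := (1 / 2 : ℝ)) (by norm_num)
        (by norm_num)).mul_const ‖(arithMean ![A, B]).1‖
  exact tendsto_sub_nhds_zero_iff.1 hdiff

theorem logMean_le_smul {t : ℝ} (ht : 0 < t) {A A' B B' : PosDefOp E}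
    (hA : A.1 ≤ t • A'.1) (hB : B.1 ≤ t • B'.1) :
    (logMean ![A, B]).1 ≤ t • (logMean ![A', B']).1 :=
  le_of_tendsto_of_tendsto' (tendsto_trapezoid A B) ((tendsto_trapezoid A' B').const_smul t)
    fun n => trapezoid_le_smul n ht hA hB

theorem logMean_comm (A B : PosDefOp E) : logMean ![A, B] = logMean ![B, A] := by
  have h := tendsto_trapezoid A B
  simp only [trapezoid_comm _ A B] at h
  exact Subtype.ext (tendsto_nhds_unique h (tendsto_trapezoid B A))

theorem logMean_split (A B : PosDefOp E) :
    logMean ![A, B] = arithMean ![logMean ![A, geomMean ![A, B]], logMean ![geomMean ![A, B], B]] :=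
  Subtype.ext (tendsto_nhds_unique ((tendsto_add_atTop_iff_nat 1).2 (tendsto_trapezoid A B))
    (((tendsto_trapezoid A (geomMean ![A, B])).add
      (tendsto_trapezoid (geomMean ![A, B]) B)).const_smul (1 / 2 : ℝ)))

theorem logMean_isMean : IsMean (logMean (E := E)) :=
  operatorMean_isMean _ _ (realLogMean_self 1)

/-- The contraction comes from the splitting `L(A, B) = (L(A, G) + L(G, B)) / 2` with `G = A # B`:
if `A` grows by a factor `R`, then `G` and the second summand grow by at most `√R`. -/
theorem isContractiveMean_logMean : IsContractiveMean (logMean (E := E)) := by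
  refine .of_two logMean_isMean logMean_comm (fun t ht A A' B B' hA hB => logMean_le_smul ht hA hB)
    fun κ hκ => ?_
  obtain ⟨ρ, hρ2, hρ1, hρ⟩ := exists_contraction_rate hκ
  refine ⟨ρ, by linarith, hρ1, fun R hR A A' B h1 h2 h3 => ?_⟩
  have hR0 : 0 < R := by linarith
  have hsR : 1 ≤ √R := Real.one_le_sqrt.2 hR
  have hsR' : √R ≤ R := Real.sqrt_le_iff.2 ⟨hR0.le, by nlinarith⟩
  have hG : (geomMean ![A, B]).1 ≤ √R • (geomMean ![A', B]).1 := geomMean_le_sqrt_smul_left hR0.le h3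
  have hL1 := logMean_le_smul hR0 h3 (PosDefOp.le_smul_of_le hG hsR')
  have hL2 := logMean_le_smul (B := B) (B' := B) (Real.sqrt_pos.2 hR0) hG
    (PosDefOp.le_smul_of_le (by rw [one_smul]) hsR)
  have hGB : (geomMean ![A', B]).1 ≤ κ • B.1 := by
    have := geomMean_le_smul_of_le (B := B) (B' := B) (t := κ) (by linarith) h1
      (PosDefOp.le_smul_of_le (by rw [one_smul]) hκ)
    rwa [← const_eq_vecCons_two, geomMean_isMean] at this
  have hAG : A'.1 ≤ κ • (geomMean ![A', B]).1 := by
    have := geomMean_le_smul_of_le (A := A') (A' := A') (B' := B) (t := κ) (by linarith)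
      (PosDefOp.le_smul_of_le (by rw [one_smul]) hκ) h1
    rwa [← const_eq_vecCons_two, geomMean_isMean] at this
  have hPQ := logMean_le_smul (by linarith) hAG hGB
  rw [logMean_split A B, logMean_split A' B]
  change (1 / 2 : ℝ) • ((logMean ![A, geomMean ![A, B]]).1 + (logMean ![geomMean ![A, B], B]).1) ≤
    (1 + ρ * (R - 1)) • (1 / 2 : ℝ) •
      ((logMean ![A', geomMean ![A', B]]).1 + (logMean ![geomMean ![A', B], B]).1)
  rw [smul_comm (1 + ρ * (R - 1))]
  refine smul_le_smul_of_nonneg_left ((add_le_add hL1 hL2).trans ?_) (by norm_num)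
  exact half_smul_add_le hPQ hR (logMean _).2.nonneg hρ1.le le_rfl (logMean _).2.nonneg
    (sqrt_le_one_add_half hR0.le) hρ

end LogMean

/-! ### The arithmetic-geometric mean of operators -/

section AGMean

variable {E : Type*} [NormedAddCommGroup E] [InnerProductSpace ℂ E] [CompleteSpace E]

theorem iterPair_succ_eq_iterPair {X : Type*} (lam nu : (Fin 2 → X) → X) (x : Fin 2 → X) (n : ℕ) :
    iterPair lam nu x (n + 1) = iterPair lam nu ![lam x, nu x] n := by
  induction n with
  | zero => rfl
  | succ n ih =>
    change ![lam (iterPair lam nu x (n + 1)), nu (iterPair lam nu x (n + 1))] = _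
    rw [ih]
    rfl

theorem iterPair_geomMean_le (x : Fin 2 → PosDefOp E) (n : ℕ) :
    iterPair geomMean arithMean x n 0 ≤ iterPair geomMean arithMean x n 1 := by
  cases n <;> exact geomMean_le_arithMean _

/-- Since `λₙ ≤ νₙ`, the geometric mean of the two is at least `λₙ # λₙ = λₙ`. -/
theorem iterPair_left_le_succ (x : Fin 2 → PosDefOp E) (n : ℕ) :
    iterPair geomMean arithMean x n 0 ≤ iterPair geomMean arithMean x (n + 1) 0 := by
  have h := le_geomMean (iterPair_geomMean_le x n)
  rwa [← eq_vecCons_two] at h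

theorem iterPair_succ_right_sub_left (x : Fin 2 → PosDefOp E) (n : ℕ) :
    (iterPair geomMean arithMean x (n + 1) 1).1 - (iterPair geomMean arithMean x n 0).1 =
      (1 / 2 : ℝ) •
        ((iterPair geomMean arithMean x n 1).1 - (iterPair geomMean arithMean x n 0).1) := by
  change (1 / 2 : ℝ) • ((iterPair geomMean arithMean x n 0).1 +
    (iterPair geomMean arithMean x n 1).1) - _ = _
  module

theorem iterPair_gap_le (x : Fin 2 → PosDefOp E) (n : ℕ) :
    (iterPair geomMean arithMean x n 1).1 - (iterPair geomMean arithMean x n 0).1 ≤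
      (1 / 2 : ℝ) ^ n •
        ((iterPair geomMean arithMean x 0 1).1 - (iterPair geomMean arithMean x 0 0).1) := by
  induction n with
  | zero => rw [pow_zero, one_smul]
  | succ n ih =>
    have h : (iterPair geomMean arithMean x n 0).1 ≤ (iterPair geomMean arithMean x (n + 1) 0).1 :=
      iterPair_left_le_succ x n
    refine (sub_le_sub_left h _).trans ?_
    rw [iterPair_succ_right_sub_left, pow_succ', mul_smul]
    exact smul_le_smul_of_nonneg_left ih (by norm_num)

/-- The arithmetic-geometric iteration converges: `λₙ` increases, and `νₙ - λₙ` is at most halved in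
each step. -/
theorem exists_tendsto_iterPair (x : Fin 2 → PosDefOp E) :
    ∃ l : PosDefOp E, Tendsto (fun n => iterPair geomMean arithMean x n 0) atTop (𝓝 l) ∧
      Tendsto (fun n => iterPair geomMean arithMean x n 1) atTop (𝓝 l) := by
  set z := iterPair geomMean arithMean x with hz
  have hle : ∀ n, (z n 0).1 ≤ (z n 1).1 := iterPair_geomMean_le x
  have hsucc : ∀ n, (z n 0).1 ≤ (z (n + 1) 0).1 := iterPair_left_le_succ x
  have hgap : ∀ n (c : E →L[ℂ] E), 0 ≤ c → c ≤ (z n 1).1 - (z n 0).1 →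
      ‖c‖ ≤ ‖(z 0 1).1 - (z 0 0).1‖ * (1 / 2 : ℝ) ^ n := by
    intro n c hc hcn
    have := CStarAlgebra.norm_le_norm_of_nonneg_of_le hc (hcn.trans (iterPair_gap_le x n))
    rwa [norm_smul, Real.norm_of_nonneg (by positivity), mul_comm] at this
  have hstep : ∀ n, dist (z n 0).1 (z (n + 1) 0).1 ≤
      ‖(z 0 1).1 - (z 0 0).1‖ * (1 / 2 : ℝ) ^ n := by
    intro n
    rw [dist_comm, dist_eq_norm]
    refine hgap n _ (sub_nonneg.2 (hsucc n)) ?_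
    have h1 : (z (n + 1) 0).1 - (z n 0).1 ≤ (z (n + 1) 1).1 - (z n 0).1 :=
      sub_le_sub_right (hle (n + 1)) _
    refine (h1.trans (iterPair_succ_right_sub_left x n).le).trans ?_
    have h2 : 0 ≤ (z n 1).1 - (z n 0).1 := sub_nonneg.2 (hle n)
    have := smul_le_smul_of_nonneg_right (show (1 / 2 : ℝ) ≤ 1 by norm_num) h2
    rwa [one_smul] at this
  obtain ⟨l, hl⟩ := cauchySeq_tendsto_of_complete
    (cauchySeq_of_le_geometric (1 / 2) _ (by norm_num) hstep)
  have hmono : ∀ n, (z 0 0).1 ≤ (z n 0).1 := fun n => by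
    induction n with
    | zero => exact le_rfl
    | succ n ih => exact ih.trans (hsucc n)
  refine ⟨⟨l, (z 0 0).2.of_le (ge_of_tendsto' hl hmono)⟩, tendsto_subtype_rng.2 hl,
    tendsto_subtype_rng.2 ?_⟩
  have hdiff : Tendsto (fun n => (z n 1).1 - (z n 0).1) atTop (𝓝 0) := by
    refine squeeze_zero_norm
      (fun n => hgap n _ (sub_nonneg.2 (hle n)) le_rfl) ?_
    simpa using (tendsto_pow_atTop_nhds_zero_of_lt_one (r := (1 / 2 : ℝ)) (by norm_num)
      (by norm_num)).const_mul ‖(z 0 1).1 - (z 0 0).1‖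
  simpa using hdiff.add hl

theorem tendsto_iterPair_agMean (x : Fin 2 → PosDefOp E) :
    Tendsto (fun n => iterPair geomMean arithMean x n 0) atTop (𝓝 (agMean x)) ∧
      Tendsto (fun n => iterPair geomMean arithMean x n 1) atTop (𝓝 (agMean x)) := by
  obtain ⟨l, h0, h1⟩ := exists_tendsto_iterPair x
  have e : agMean x = l := h0.limUnder_eq
  rw [e]
  exact ⟨h0, h1⟩

theorem iterPair_const {X : Type*} {lam nu : (Fin 2 → X) → X} (hlam : IsMean lam) (hnu : IsMean nu)
    (a : X) (n : ℕ) : iterPair lam nu (fun _ => a) n = fun _ => a := by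
  induction n with
  | zero => rw [iterPair, hlam, hnu, const_eq_vecCons_two]
  | succ n ih => rw [iterPair, ih, hlam, hnu, const_eq_vecCons_two]

theorem isIteratedComposition_agMean :
    IsIteratedComposition (X := PosDefOp E) geomMean arithMean agMean where
  isMean A := by
    have h := (tendsto_iterPair_agMean fun _ => A).1
    simp only [iterPair_const geomMean_isMean arithMean_isMean] at h
    exact tendsto_nhds_unique h tendsto_const_nhds
  tendsto_left x := (tendsto_iterPair_agMean x).1
  tendsto_right x := (tendsto_iterPair_agMean x).2

theorem iterPair_le_smul {t : ℝ} (ht : 0 < t) {x y : Fin 2 → PosDefOp E}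
    (h : ∀ i, (x i).1 ≤ t • (y i).1) (n : ℕ) (i : Fin 2) :
    (iterPair geomMean arithMean x n i).1 ≤ t • (iterPair geomMean arithMean y n i).1 := by
  have key : ∀ x y : Fin 2 → PosDefOp E, (∀ i, (x i).1 ≤ t • (y i).1) → ∀ i : Fin 2,
      ((![geomMean x, arithMean x] : Fin 2 → PosDefOp E) i).1 ≤
        t • ((![geomMean y, arithMean y] : Fin 2 → PosDefOp E) i).1 := by
    intro x y h i
    rw [eq_vecCons_two x, eq_vecCons_two y]
    fin_cases i
    · exact geomMean_le_smul_of_le ht.le (h 0) (h 1)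
    · exact arithMean_le_smul_of_le (h 0) (h 1)
  induction n generalizing i with
  | zero => exact key x y h i
  | succ n ih => exact key _ _ ih i

theorem agMean_le_smul {t : ℝ} (ht : 0 < t) {x y : Fin 2 → PosDefOp E}
    (h : ∀ i, (x i).1 ≤ t • (y i).1) : (agMean x).1 ≤ t • (agMean y).1 :=
  le_of_tendsto_of_tendsto' (tendsto_subtype_rng.1 (tendsto_iterPair_agMean x).1)
    ((tendsto_subtype_rng.1 (tendsto_iterPair_agMean y).1).const_smul t)
    fun n => iterPair_le_smul ht h n 0

theorem agMean_eq_agMean_geomMean_arithMean (x : Fin 2 → PosDefOp E) :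
    agMean x = agMean ![geomMean x, arithMean x] := by
  have h := (tendsto_add_atTop_iff_nat 1).2 (tendsto_iterPair_agMean x).1
  simp only [iterPair_succ_eq_iterPair] at h
  exact tendsto_nhds_unique h (tendsto_iterPair_agMean _).1

theorem agMean_comm (A B : PosDefOp E) : agMean ![A, B] = agMean ![B, A] := by
  rw [agMean_eq_agMean_geomMean_arithMean, geomMean_comm, arithMean_comm,
    ← agMean_eq_agMean_geomMean_arithMean]

/-- The first step of the iteration already contracts in each variable. -/
theorem isContractiveMean_agMean : IsContractiveMean (agMean (E := E)) := by
  refine .of_two isIteratedComposition_agMean.isMean agMean_comm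
    (fun t ht A A' B B' hA hB => agMean_le_smul ht (Fin.forall_fin_two.2 ⟨hA, hB⟩)) fun κ hκ => ?_
  obtain ⟨ρ, hρ2, hρ1, hρ⟩ := exists_contraction_rate hκ
  refine ⟨ρ, by linarith, hρ1, fun R hR A A' B h1 _ h3 => ?_⟩
  have hR0 : 0 < R := by linarith
  rw [agMean_eq_agMean_geomMean_arithMean ![A, B], agMean_eq_agMean_geomMean_arithMean ![A', B]]
  refine agMean_le_smul (by nlinarith) (Fin.forall_fin_two.2 ⟨?_, ?_⟩)
  · refine PosDefOp.le_smul_of_le (geomMean_le_sqrt_smul_left hR0.le h3) ?_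
    nlinarith [sqrt_le_one_add_half hR0.le]
  · change (1 / 2 : ℝ) • (A.1 + B.1) ≤ (1 + ρ * (R - 1)) • (1 / 2 : ℝ) • (A'.1 + B.1)
    rw [smul_comm (1 + ρ * (R - 1))]
    refine smul_le_smul_of_nonneg_left (le_trans ?_ (half_smul_add_le h1 hR B.2.nonneg hρ1.le
      le_rfl A'.2.nonneg (s := 1) (by linarith) hρ)) (by norm_num)
    rw [one_smul]
    exact add_le_add_left h3 _

end AGMean

/-! ### Comparison of the two means -/

section LogMeanLeAGMean

variable {E : Type*} [NormedAddCommGroup E] [InnerProductSpace ℂ E] [CompleteSpace E]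

/-- The arithmetic-geometric iteration of operators is given, by functional calculus, by that of
positive reals. -/
theorem iterPair_eq_meanOfFun (x : Fin 2 → PosDefOp E) (n : ℕ) (i : Fin 2) :
    let z := fun t : ℝ =>
      iterPair (fun y : Fin 2 → ℝ => √(y 0 * y 1)) (fun y => (y 0 + y 1) / 2) ![1, t] n
    ContinuousOn (fun t => z t i) (Set.Ioi 0) ∧
      (iterPair geomMean arithMean x n i).1 = meanOfFun (fun t => z t i) (x 0).1 (x 1).1 := by
  have key : ∀ (y : Fin 2 → PosDefOp E) (p : Fin 2 → ℝ → ℝ),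
      (∀ i, ContinuousOn (p i) (Set.Ioi 0)) → (∀ i t, 0 < t → 0 < p i t) →
      (∀ i, (y i).1 = meanOfFun (p i) (x 0).1 (x 1).1) → ∀ i,
      let q := fun t : ℝ => (![√(p 0 t * p 1 t), (p 0 t + p 1 t) / 2] : Fin 2 → ℝ)
      ContinuousOn (fun t => q t i) (Set.Ioi 0) ∧
        ((![geomMean y, arithMean y] : Fin 2 → PosDefOp E) i).1 =
          meanOfFun (fun t => q t i) (x 0).1 (x 1).1 := by
    intro y p hc hp hy i
    fin_cases i
    · exact ⟨((hc 0).mul (hc 1)).sqrt, geomMean_eq_meanOfFun (hc 0) (hc 1) (hp 0) (hp 1)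
        (x 0).2 (x 1).2 (hy 0) (hy 1)⟩
    · exact ⟨((hc 0).add (hc 1)).div_const 2, arithMean_eq_meanOfFun (hc 0) (hc 1)
        (x 0).2 (x 1).2 (hy 0) (hy 1)⟩
  induction n generalizing i with
  | zero =>
    exact key x ![fun _ => 1, fun t => t]
      (Fin.forall_fin_two.2 ⟨continuousOn_const, continuousOn_id⟩)
      (Fin.forall_fin_two.2 ⟨fun _ _ => one_pos, fun _ => id⟩)
      (Fin.forall_fin_two.2 ⟨(meanOfFun_one (x 0).2 (x 1).2).symm,
        (meanOfFun_id (x 0).2 (x 1).2).symm⟩) i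
  | succ n ih =>
    refine key _ (fun i t => iterPair (fun y : Fin 2 → ℝ => √(y 0 * y 1))
      (fun y => (y 0 + y 1) / 2) ![1, t] n i) (fun i => (ih i).1) (fun i t ht => ?_)
      (fun i => (ih i).2) i
    have h := realLogMean_le_iterPair ![1, t] one_pos ht n
    exact Fin.forall_fin_two (p := fun i => 0 < iterPair (fun y : Fin 2 → ℝ => √(y 0 * y 1))
      (fun y => (y 0 + y 1) / 2) ![1, t] n i).2 ⟨h.1, h.2.1⟩ i

theorem logMean_le_agMean : (logMean : (Fin 2 → PosDefOp E) → PosDefOp E) ≤ agMean := by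
  intro x
  refine ge_of_tendsto' ((tendsto_add_atTop_iff_nat 1).2 (tendsto_iterPair_agMean x).2) fun n => ?_
  obtain ⟨hc, h⟩ := iterPair_eq_meanOfFun x (n + 1) 1
  change (logMean x).1 ≤ (iterPair geomMean arithMean x (n + 1) 1).1
  rw [h]
  refine meanOfFun_mono continuousOn_realLogMean_one hc (fun t ht => ?_) (x 0).2 (x 1).2
  obtain ⟨h0, h1, h2⟩ := realLogMean_le_iterPair ![1, t] one_pos ht n
  exact h2.trans (realLogMean_le_half_add h0 h1)

end LogMeanLeAGMean

/-- On the positive definite operators of a complex Hilbert space, the arithmetic-geometric mean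
exists, both it and the logarithmic mean have inductive `β`-extensions of all orders, and these
satisfy `Lₙ(A₁, …, Aₙ) ≤ AGMₙ(A₁, …, Aₙ)` for every `n > 2`. -/
theorem mainTheorem6 {E : Type*} [NormedAddCommGroup E] [InnerProductSpace ℂ E] [CompleteSpace E] :
    IsIteratedComposition (X := PosDefOp E) geomMean arithMean agMean ∧
    (∃ L : (n : ℕ) → (Fin n → PosDefOp E) → PosDefOp E, IsBetaExtensionFamily logMean L) ∧
    (∃ AGM : (n : ℕ) → (Fin n → PosDefOp E) → PosDefOp E, IsBetaExtensionFamily agMean AGM) ∧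
    ∀ L AGM : (n : ℕ) → (Fin n → PosDefOp E) → PosDefOp E,
      IsBetaExtensionFamily logMean L → IsBetaExtensionFamily agMean AGM →
        ∀ n : ℕ, 2 < n → ∀ A : Fin n → PosDefOp E,
          (L n A : E →L[ℂ] E) ≤ (AGM n A : E →L[ℂ] E) :=
  ⟨isIteratedComposition_agMean, isContractiveMean_logMean.exists_isBetaExtensionFamily,
    isContractiveMean_agMean.exists_isBetaExtensionFamily, fun _ _ hL hAGM _ hn A =>
      hL.le_of_le hAGM logMean_le_agMean isContractiveMean_agMean.monotone hn.le A⟩
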